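/- Let $p$ be a prime and let $T$ be the $p$-adic rooted tree, whose vertices are the finite words over an alphabet $X=\{x_1,\dots,x_p\}$, each word $w$ being joined to the words $wx$ with $x\in X$. Let $a$ and $b$ be the automorphisms of $T$ that fix the empty word and are defined recursively, for every word $v$, by $$a(x_iv)=x_iv,\qquad b(x_iv)=x_{i+1}v\qquad(1\le i<p),$$ $$a(x_pv)=x_p\,b(v),\qquad b(x_pv)=x_1\,a(v),$$ that is, $a=(1,\dots,1,b)$ and $b=(1,\dots,1,a)\sigma$ with $\sigma=(x_1\,x_2\,\cdots\,x_p)$. Let $G=\langle a,b\rangle\le\operatorname{Aut}(T)$ be the $p$-Basilica group. Theorem 1.4. Every maximal subgroup of $G$ has finite index in $G$, and $G$ has infinitely many non-normal maximal subgroups. Moreover, for every prime $q$ such that $p$ divides $q-1$, the group $G$ has a non-normal maximal subgroup of index $q$. -/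

import Mathlib

namespace PBasilica

/-- The word `w` is a descendant of the word `u`, that is, `w = u x` for a letter `x`. -/
def IsChild {p : ℕ} (u w : List (Fin p)) : Prop := ∃ x : Fin p, w = u ++ [x]

/-- The `p`-adic tree `T`: its vertices are the words over the alphabet `Fin p`, whose letters
`0, …, p - 1` stand for `x₁, …, x_p`, and `u` is joined to `u x` for every letter `x`. -/
def tree (p : ℕ) : SimpleGraph (List (Fin p)) := SimpleGraph.fromRel IsChild

mutual

/-- The action of `a` on words: `a` has trivial label at the root, its section at the last letter
is `b`, and its sections at the other letters are trivial, i.e. `ψ(a) = (1, …, 1, b)`. -/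
def aFun (p : ℕ) : List (Fin p) → List (Fin p)
  | [] => []
  | x :: v => x :: (if (x : ℕ) + 1 = p then bFun p v else v)

/-- The action of `b` on words: `b` has label `σ = (x₁ x₂ ⋯ x_p)` at the root, its section at the
last letter is `a`, and its sections at the other letters are trivial, i.e.
`ψ(b) = (1, …, 1, a) σ`. -/
def bFun (p : ℕ) : List (Fin p) → List (Fin p)
  | [] => []
  | x :: v => finRotate p x :: (if (x : ℕ) + 1 = p then aFun p v else v)

end

mutual

/-- The inverse of `aFun`. -/
def aInv (p : ℕ) : List (Fin p) → List (Fin p)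
  | [] => []
  | x :: v => x :: (if (x : ℕ) + 1 = p then bInv p v else v)

/-- The inverse of `bFun`. -/
def bInv (p : ℕ) : List (Fin p) → List (Fin p)
  | [] => []
  | y :: v => (finRotate p).symm y ::
      (if ((finRotate p).symm y : ℕ) + 1 = p then aInv p v else v)

end

theorem leftInv (p : ℕ) (v : List (Fin p)) :
    aInv p (aFun p v) = v ∧ bInv p (bFun p v) = v := by
  induction v with
  | nil => simp [aFun, bFun, aInv, bInv]
  | cons x v ih =>
    obtain ⟨h1, h2⟩ := ih
    by_cases h : (x : ℕ) + 1 = p <;>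
      simp only [aFun, bFun, aInv, bInv, Equiv.symm_apply_apply, h, h1, h2, if_true, if_false,
        and_self]

theorem rightInv (p : ℕ) (v : List (Fin p)) :
    aFun p (aInv p v) = v ∧ bFun p (bInv p v) = v := by
  induction v with
  | nil => simp [aFun, bFun, aInv, bInv]
  | cons x v ih =>
    obtain ⟨h1, h2⟩ := ih
    constructor
    · by_cases h : (x : ℕ) + 1 = p <;> simp [aFun, aInv, h, h2]
    · by_cases h : ((finRotate p).symm x : ℕ) + 1 = p <;> simp only [bFun, bInv, Equiv.apply_symm_apply, h, h1, if_true, if_false]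

theorem IsChild.nil_single {p : ℕ} (x : Fin p) : IsChild [] [x] := ⟨x, rfl⟩

theorem IsChild.cons {p : ℕ} {u w : List (Fin p)} (x : Fin p) (h : IsChild u w) :
    IsChild (x :: u) (x :: w) := by
  obtain ⟨y, rfl⟩ := h
  exact ⟨y, rfl⟩

theorem isChild_fun (p : ℕ) (u : List (Fin p)) (x : Fin p) :
    IsChild (aFun p u) (aFun p (u ++ [x])) ∧ IsChild (bFun p u) (bFun p (u ++ [x])) := by
  induction u with
  | nil => simp [aFun, bFun, IsChild]
  | cons y u ih =>
    by_cases h : (y : ℕ) + 1 = p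
    · simpa [aFun, bFun, h] using And.intro (ih.2.cons y) (ih.1.cons (finRotate p y))
    · simp [aFun, bFun, h, IsChild]

theorem isChild_inv (p : ℕ) (u : List (Fin p)) (x : Fin p) :
    IsChild (aInv p u) (aInv p (u ++ [x])) ∧ IsChild (bInv p u) (bInv p (u ++ [x])) := by
  induction u with
  | nil => simp [aInv, bInv, IsChild]
  | cons y u ih =>
    constructor
    · by_cases h : (y : ℕ) + 1 = p
      · simpa [aInv, h] using ih.2.cons y
      · simp [aInv, h, IsChild]
    · by_cases h : ((finRotate p).symm y : ℕ) + 1 = p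
      · simpa only [List.cons_append, bInv, h, if_true] using ih.1.cons ((finRotate p).symm y)
      · simp only [List.cons_append, bInv, h, if_false]
        exact ⟨x, rfl⟩

theorem adj_map {p : ℕ} {f : List (Fin p) → List (Fin p)} (hf : Function.Injective f)
    (h : ∀ u x, IsChild (f u) (f (u ++ [x]))) {u w : List (Fin p)} (huw : (tree p).Adj u w) :
    (tree p).Adj (f u) (f w) := by
  simp only [tree, SimpleGraph.fromRel_adj] at huw ⊢
  refine ⟨hf.ne huw.1, ?_⟩
  rcases huw.2 with ⟨x, rfl⟩ | ⟨x, rfl⟩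
  · exact Or.inl (h u x)
  · exact Or.inr (h w x)

/-- The automorphism `a` of the `p`-adic tree, with `ψ(a) = (1, …, 1, b)`. -/
def a (p : ℕ) : tree p ≃g tree p where
  toFun := aFun p
  invFun := aInv p
  left_inv v := (leftInv p v).1
  right_inv v := (rightInv p v).1
  map_rel_iff' {u w} := by
    have hl : Function.LeftInverse (aInv p) (aFun p) := fun v => (leftInv p v).1
    have hr : Function.LeftInverse (aFun p) (aInv p) := fun v => (rightInv p v).1
    refine ⟨fun h => ?_, fun h => adj_map hl.injective (fun u x => (isChild_fun p u x).1) h⟩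
    have h' := adj_map hr.injective (fun u x => (isChild_inv p u x).1) h
    simpa [hl u, hl w] using h'

/-- The automorphism `b` of the `p`-adic tree, with `ψ(b) = (1, …, 1, a) σ`. -/
def b (p : ℕ) : tree p ≃g tree p where
  toFun := bFun p
  invFun := bInv p
  left_inv v := (leftInv p v).2
  right_inv v := (rightInv p v).2
  map_rel_iff' {u w} := by
    have hl : Function.LeftInverse (bInv p) (bFun p) := fun v => (leftInv p v).2
    have hr : Function.LeftInverse (bFun p) (bInv p) := fun v => (rightInv p v).2
    refine ⟨fun h => ?_, fun h => adj_map hl.injective (fun u x => (isChild_fun p u x).2) h⟩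
    have h' := adj_map hr.injective (fun u x => (isChild_inv p u x).2) h
    simpa [hl u, hl w] using h'

end PBasilica

/-- The `p`-Basilica group: the subgroup of the group of graph automorphisms of the `p`-adic tree
that is generated by `a` and `b`. -/
def pBasilica (p : ℕ) : Subgroup (PBasilica.tree p ≃g PBasilica.tree p) :=
  Subgroup.closure {PBasilica.a p, PBasilica.b p}

set_option linter.unusedSectionVars false
open scoped commutatorElement

-- The argument uses only the axioms of `BasilicaGroup`. Exponent sums `α` (of `a`) and `β` (of `b`)
-- are well defined on `G` and give a map onto `ℤ × ℤ` whose kernel `expKer` is the commutator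
-- subgroup. An element permutes the letters by a shift by `β` mod `p`. If it fixes them, its
-- sections `s` all satisfy `p * α s = β g`, and their `β` add up to `α g`. Conversely, every tuple
-- of sections with constant `α` occurs. This makes `G` weakly branch over `expKer`.
--
-- Finite index. Double commutators show that each nontrivial normal subgroup contains `lift^[n]
-- ⁅expKer, expKer⁆` for some `n`. Above such a subgroup lie two finitely generated abelian layers
-- and then a finite quotient, so a maximal subgroup that contains a nontrivial normal subgroup has
-- finite index. What remains is to exclude a `CoreFreeMaximal` subgroup `M`, one with `M ⊔ N = ⊤`
-- for all nontrivial normal `N`. The letter-fixing elements of `M` have their sections at a given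
-- letter in a proper subgroup (`secImage_ne_top`), hence in a new core-free maximal subgroup. This
-- permits two descents along sections.
--
-- The first descent shortens a word for an element of `M` with the exponents of `τ = b a⁻¹`, until
-- a core-free maximal subgroup contains `τ` itself. Since `τ ^ p` has every section equal to `τ⁻¹`,
-- membership of `τ` persists in all later steps. The second descent follows an element with `α + β
-- ≠ 0` and counts its letters `a`, `a⁻¹` between powers of `τ`. The count falls to at most one,
-- which forces either `α + β = 0` or `a ∈ M`, hence `M = ⊤`; both are contradictions.
--
-- Non-normal subgroups. If `ω` has order `p` in `(ZMod q)ˣ`, then `G` acts on `ZMod q` by affine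
-- maps, `b` as multiplication by `ω` and `a` as a nonzero translation. A point stabilizer has prime
-- index `q` and is not normal. Infinitely many primes `q ≡ 1` mod `p` give infinitely many indices.

/-- A self-similar group over the alphabet `Fin p` which is generated by `a = (1, …, 1, b)` and
`b = (1, …, 1, a) σ` and which acts faithfully on the tree of words: `act g x` is the image of the
letter `x` under `g` and `sec g x` is the section of `g` at `x`. -/
structure BasilicaGroup (p : ℕ) (G : Type) [Group G] where
  a : G
  b : G
  act : G → Fin p → Fin p
  sec : G → Fin p → G
  act_one : ∀ x, act 1 x = x
  sec_one : ∀ x, sec 1 x = 1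
  act_mul : ∀ g h x, act (g * h) x = act g (act h x)
  sec_mul : ∀ g h x, sec (g * h) x = sec g (act h x) * sec h x
  act_a : ∀ x, act a x = x
  act_b : ∀ x, (act b x : ℕ) = if (x : ℕ) + 1 = p then 0 else (x : ℕ) + 1
  sec_a : ∀ x, sec a x = if (x : ℕ) + 1 = p then b else 1
  sec_b : ∀ x, sec b x = if (x : ℕ) + 1 = p then a else 1
  closure_eq : Subgroup.closure {a, b} = ⊤
  faithful : ∀ P : G → Prop, (∀ g, P g → ∀ x, act g x = x ∧ P (sec g x)) → ∀ g, P g → g = 1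

-- Sections and exponent sums

namespace BasilicaGroup

attribute [simp] act_one sec_one act_mul sec_mul act_a

variable {p : ℕ} {G : Type} [Group G] (S : BasilicaGroup p G)

@[simp] theorem act_inv_act (g : G) (x : Fin p) : S.act g⁻¹ (S.act g x) = x := by
  rw [← S.act_mul, inv_mul_cancel, S.act_one]

@[simp] theorem act_act_inv (g : G) (x : Fin p) : S.act g (S.act g⁻¹ x) = x := by
  rw [← S.act_mul, mul_inv_cancel, S.act_one]

theorem sec_inv (g : G) (x : Fin p) : S.sec g⁻¹ x = (S.sec g (S.act g⁻¹ x))⁻¹ := by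
  have h := S.sec_mul g g⁻¹ x
  rw [mul_inv_cancel, S.sec_one] at h
  exact (inv_eq_of_mul_eq_one_right h.symm).symm

/-- The permutation of the letters induced by a group element. -/
def actEquiv (g : G) : Equiv.Perm (Fin p) where
  toFun := S.act g
  invFun := S.act g⁻¹
  left_inv := S.act_inv_act g
  right_inv := S.act_act_inv g

@[simp] theorem actEquiv_apply (g : G) (x : Fin p) : S.actEquiv g x = S.act g x := rfl

theorem eq_one_of_sec {g : G} (h1 : ∀ x, S.act g x = x) (h2 : ∀ x, S.sec g x = 1) : g = 1 := by
  refine S.faithful (fun g => ∀ x, S.act g x = x ∧ S.sec g x = 1) ?_ g fun x => ⟨h1 x, h2 x⟩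
  intro g hg x
  refine ⟨(hg x).1, fun y => ?_⟩
  rw [(hg x).2]
  simp

theorem ext_sec {g h : G} (h1 : ∀ x, S.act g x = S.act h x) (h2 : ∀ x, S.sec g x = S.sec h x) :
    g = h := by
  rw [← inv_mul_eq_one]
  refine S.eq_one_of_sec (fun x => ?_) fun x => ?_
  · rw [S.act_mul, ← h1, S.act_inv_act]
  · rw [S.sec_mul, S.sec_inv, ← h1, S.act_inv_act, h2, inv_mul_cancel]

theorem induction_gen {P : G → Prop} (ha : P S.a) (hb : P S.b) (h1 : P 1)
    (hm : ∀ g h, P g → P h → P (g * h)) (hi : ∀ g, P g → P g⁻¹) (g : G) : P g := by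
  have hg : g ∈ Subgroup.closure {S.a, S.b} := S.closure_eq ▸ Subgroup.mem_top g
  induction hg using Subgroup.closure_induction with
  | mem x hx => rcases hx with rfl | rfl <;> assumption
  | one => exact h1
  | mul x y _ _ hx hy => exact hm x y hx hy
  | inv x _ hx => exact hi x hx

/-- The relation "`g` is represented by a word of exponents `z`". -/
def graphExp : Subgroup (G × Multiplicative (ℤ × ℤ)) :=
  Subgroup.closure {(S.a, Multiplicative.ofAdd (1, 0)), (S.b, Multiplicative.ofAdd (0, 1))}

theorem exists_graphExp (g : G) : ∃ z, (g, z) ∈ S.graphExp := by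
  refine S.induction_gen (P := fun g => ∃ z, (g, z) ∈ S.graphExp)
    ⟨_, Subgroup.subset_closure (Or.inl rfl)⟩
    ⟨_, Subgroup.subset_closure (Or.inr rfl)⟩ ⟨1, S.graphExp.one_mem⟩ ?_ ?_ g
  · rintro g h ⟨y, hy⟩ ⟨z, hz⟩
    exact ⟨y * z, S.graphExp.mul_mem hy hz⟩
  · rintro g ⟨y, hy⟩
    exact ⟨y⁻¹, S.graphExp.inv_mem hy⟩

/-- Each `a` of a word puts one `b` into the sections, while `b` acts as an odometer digit: it
raises a letter by one or carries, and each carry leaves an `a`. The count is made on `graphExp`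
because exponents are not yet known to depend on the element alone. -/
theorem graphExp_sec [NeZero p] {u : G × Multiplicative (ℤ × ℤ)} (hu : u ∈ S.graphExp) :
    ∃ s : Fin p → ℤ × ℤ, (∀ x, (S.sec u.1 x, Multiplicative.ofAdd (s x)) ∈ S.graphExp) ∧
      ∑ x, (s x).2 = (Multiplicative.toAdd u.2).1 ∧
      ∀ x, p * (s x).1 + (S.act u.1 x : ℕ) = (Multiplicative.toAdd u.2).2 + (x : ℕ) := by
  have hp : 0 < p := Nat.pos_of_neZero p
  have hl : ∀ x : Fin p, (x : ℕ) + 1 = p ↔ x = ⟨p - 1, by omega⟩ := by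
    intro x
    rw [Fin.ext_iff]
    simp only
    omega
  induction hu using Subgroup.closure_induction with
  | mem u hu =>
    rcases hu with rfl | rfl
    · refine ⟨fun x => if (x : ℕ) + 1 = p then (0, 1) else 0, fun x => ?_, ?_, fun x => ?_⟩
      · simp only [S.sec_a]
        split_ifs
        · exact Subgroup.subset_closure (Or.inr rfl)
        · exact S.graphExp.one_mem
      · simp only [hl, apply_ite Prod.snd]
        simp
      · simp only [apply_ite Prod.fst]
        simp
    · refine ⟨fun x => if (x : ℕ) + 1 = p then (1, 0) else 0, fun x => ?_, ?_, fun x => ?_⟩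
      · simp only [S.sec_b]
        split_ifs
        · exact Subgroup.subset_closure (Or.inl rfl)
        · exact S.graphExp.one_mem
      · simp only [apply_ite Prod.snd]
        simp
      · simp only [S.act_b, apply_ite Prod.fst, toAdd_ofAdd]
        split_ifs with h
        · push_cast [← h]
          ring
        · simp
          ring
  | one =>
    refine ⟨0, fun x => ?_, by simp, by simp⟩
    rw [Prod.fst_one, S.sec_one]
    exact S.graphExp.one_mem
  | mul u v _ _ hu hv =>
    obtain ⟨s, h1, h2, h3⟩ := hu
    obtain ⟨t, k1, k2, k3⟩ := hv
    refine ⟨fun x => s (S.act v.1 x) + t x, fun x => ?_, ?_, fun x => ?_⟩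
    · rw [Prod.fst_mul, S.sec_mul]
      exact S.graphExp.mul_mem (h1 _) (k1 x)
    · simp only [Prod.snd_add, Finset.sum_add_distrib, k2, Prod.snd_mul, toAdd_mul, Prod.fst_add]
      rw [← h2, ← Equiv.sum_comp (S.actEquiv v.1) fun x => (s x).2]
      simp
    · have e1 := h3 (S.act v.1 x)
      have e2 := k3 x
      simp only [Prod.fst_mul, S.act_mul, Prod.fst_add, Prod.snd_mul, toAdd_mul, Prod.snd_add]
      linarith
  | inv u _ hu =>
    obtain ⟨s, h1, h2, h3⟩ := hu
    refine ⟨fun x => - s (S.act u.1⁻¹ x), fun x => ?_, ?_, fun x => ?_⟩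
    · rw [Prod.fst_inv, S.sec_inv]
      exact S.graphExp.inv_mem (h1 _)
    · simp only [Prod.snd_neg, Finset.sum_neg_distrib, Prod.snd_inv, toAdd_inv, Prod.fst_neg]
      rw [← h2, ← Equiv.sum_comp (S.actEquiv u.1⁻¹) fun x => (s x).2]
      simp
    · have e1 := h3 (S.act u.1⁻¹ x)
      simp only [S.act_act_inv] at e1
      simp only [Prod.fst_neg, Prod.snd_inv, toAdd_inv, Prod.fst_inv, Prod.snd_neg]
      linarith

/-- Well-definedness of the exponents: the sections of a word for `1` are again words for `1`, and
two levels of sections show that its `b`-exponent is infinitely divisible by `p`. -/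
theorem graphExp_one [Fact p.Prime] {z : Multiplicative (ℤ × ℤ)} (hz : (1, z) ∈ S.graphExp) :
    z = 1 := by
  have hp : p.Prime := Fact.out
  have key : ∀ z : Multiplicative (ℤ × ℤ), (1, z) ∈ S.graphExp →
      ∃ s : Fin p → ℤ × ℤ, (∀ x, ((1 : G), Multiplicative.ofAdd (s x)) ∈ S.graphExp) ∧
        ∑ x, (s x).2 = (Multiplicative.toAdd z).1 ∧
        ∀ x, p * (s x).1 = (Multiplicative.toAdd z).2 := by
    intro z hz
    simpa using S.graphExp_sec hz
  have hdiv : ∀ k : ℕ, ∀ z : Multiplicative (ℤ × ℤ), (1, z) ∈ S.graphExp →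
      (p : ℤ) ^ k ∣ (Multiplicative.toAdd z).2 := by
    intro k
    induction k with
    | zero => simp
    | succ k ih =>
      intro z hz
      obtain ⟨s, h1, -, h3⟩ := key z hz
      obtain ⟨t, k1, k2, -⟩ := key _ (h1 0)
      -- The `b`-exponent is `p` times the `a`-exponent of a section, and that one is a sum of
      -- `b`-exponents one level further down.
      rw [← h3 0, pow_succ', ← toAdd_ofAdd (s 0), ← k2]
      exact mul_dvd_mul_left _ (Finset.dvd_sum fun x _ => ih _ (k1 x))
  have h0 : ∀ z : Multiplicative (ℤ × ℤ), (1, z) ∈ S.graphExp →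
      (Multiplicative.toAdd z).2 = 0 := by
    intro z hz
    by_contra hne
    obtain ⟨k, hk⟩ := pow_unbounded_of_one_lt (|(Multiplicative.toAdd z).2|)
      (show (1 : ℤ) < p by exact_mod_cast hp.one_lt)
    exact absurd (Int.le_of_dvd (abs_pos.mpr hne) ((dvd_abs _ _).mpr (hdiv k z hz))) (by omega)
  obtain ⟨s, h1, h2, -⟩ := key z hz
  apply Multiplicative.toAdd.injective
  refine Prod.ext ?_ (h0 z hz)
  rw [← h2]
  exact Finset.sum_eq_zero fun x _ => h0 _ (h1 x)

variable [Fact p.Prime]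

/-- The exponents of `g` with respect to `a` and `b`. -/
noncomputable def expHom : G →* Multiplicative (ℤ × ℤ) := by
  have huniq : ∀ g y z, (g, y) ∈ S.graphExp → (g, z) ∈ S.graphExp → y = z := by
    intro g y z hy hz
    have h := S.graphExp.mul_mem hy (S.graphExp.inv_mem hz)
    rw [Prod.inv_mk, Prod.mk_mul_mk, mul_inv_cancel] at h
    exact mul_inv_eq_one.mp (S.graphExp_one h)
  refine MonoidHom.mk' (fun g => (S.exists_graphExp g).choose) fun g h => ?_
  exact huniq _ _ _ (S.exists_graphExp (g * h)).choose_spec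
    (S.graphExp.mul_mem (S.exists_graphExp g).choose_spec (S.exists_graphExp h).choose_spec)

theorem mem_graphExp_iff {g : G} {z : Multiplicative (ℤ × ℤ)} :
    (g, z) ∈ S.graphExp ↔ S.expHom g = z := by
  have hspec : (g, S.expHom g) ∈ S.graphExp := (S.exists_graphExp g).choose_spec
  constructor
  · intro h
    have h' := S.graphExp.mul_mem hspec (S.graphExp.inv_mem h)
    rw [Prod.inv_mk, Prod.mk_mul_mk, mul_inv_cancel] at h'
    exact mul_inv_eq_one.mp (S.graphExp_one h')
  · rintro rfl
    exact hspec

/-- The exponent sum of `a`. -/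
noncomputable def α (g : G) : ℤ := (Multiplicative.toAdd (S.expHom g)).1

/-- The exponent sum of `b`. -/
noncomputable def β (g : G) : ℤ := (Multiplicative.toAdd (S.expHom g)).2

@[simp] theorem α_one : S.α 1 = 0 := by simp [α]
@[simp] theorem β_one : S.β 1 = 0 := by simp [β]
@[simp] theorem α_mul (g h : G) : S.α (g * h) = S.α g + S.α h := by simp [α]
@[simp] theorem β_mul (g h : G) : S.β (g * h) = S.β g + S.β h := by simp [β]
@[simp] theorem α_inv (g : G) : S.α g⁻¹ = - S.α g := by simp [α]
@[simp] theorem β_inv (g : G) : S.β g⁻¹ = - S.β g := by simp [β]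
@[simp] theorem α_pow (g : G) (n : ℕ) : S.α (g ^ n) = n * S.α g := by simp [α]
@[simp] theorem β_pow (g : G) (n : ℕ) : S.β (g ^ n) = n * S.β g := by simp [β]
@[simp] theorem α_zpow (g : G) (n : ℤ) : S.α (g ^ n) = n * S.α g := by simp [α]
@[simp] theorem β_zpow (g : G) (n : ℤ) : S.β (g ^ n) = n * S.β g := by simp [β]

theorem expHom_a : S.expHom S.a = Multiplicative.ofAdd (1, 0) :=
  S.mem_graphExp_iff.mp (Subgroup.subset_closure (Or.inl rfl))

theorem expHom_b : S.expHom S.b = Multiplicative.ofAdd (0, 1) :=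
  S.mem_graphExp_iff.mp (Subgroup.subset_closure (Or.inr rfl))

@[simp] theorem α_a : S.α S.a = 1 := by simp [α, expHom_a]
@[simp] theorem β_a : S.β S.a = 0 := by simp [β, expHom_a]
@[simp] theorem α_b : S.α S.b = 0 := by simp [α, expHom_b]
@[simp] theorem β_b : S.β S.b = 1 := by simp [β, expHom_b]

theorem sum_β_sec (g : G) : ∑ x, S.β (S.sec g x) = S.α g := by
  obtain ⟨s, h1, h2, -⟩ := S.graphExp_sec (S.mem_graphExp_iff.mpr (rfl : S.expHom g = _))
  simp only [α, β]
  rw [← h2]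
  refine Finset.sum_congr rfl fun x _ => ?_
  rw [S.mem_graphExp_iff.mp (h1 x), toAdd_ofAdd]

theorem p_mul_α_sec (g : G) (x : Fin p) :
    p * S.α (S.sec g x) + (S.act g x : ℕ) = S.β g + (x : ℕ) := by
  obtain ⟨s, h1, -, h3⟩ := S.graphExp_sec (S.mem_graphExp_iff.mpr (rfl : S.expHom g = _))
  have := h3 x
  simp only [α, β]
  rw [S.mem_graphExp_iff.mp (h1 x), toAdd_ofAdd]
  exact this

/-- The formula `p_mul_α_sec` read modulo `p`. Thus an element fixes one letter only if it fixes all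
of them. -/
theorem act_eq_self_iff (g : G) (x : Fin p) : S.act g x = x ↔ (p : ℤ) ∣ S.β g := by
  have h := S.p_mul_α_sec g x
  constructor
  · intro hx
    rw [hx] at h
    exact ⟨_, (add_right_cancel h).symm⟩
  · rintro ⟨k, hk⟩
    rw [hk] at h
    have h1 : ((S.act g x : ℕ) : ℤ) % p = ((x : ℕ) : ℤ) % p := by
      have : ((S.act g x : ℕ) : ℤ) = ((x : ℕ) : ℤ) + p * (k - S.α (S.sec g x)) := by linarith
      rw [this, Int.add_mul_emod_self_left]
    rw [Int.emod_eq_of_lt (by omega) (by omega), Int.emod_eq_of_lt (by omega) (by omega)] at h1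
    exact Fin.ext (by exact_mod_cast h1)

theorem α_sec_of_act {g : G} {x : Fin p} (hx : S.act g x = x) : p * S.α (S.sec g x) = S.β g := by
  have h := S.p_mul_α_sec g x
  rw [hx] at h
  exact add_right_cancel h

end BasilicaGroup

-- The first-level stabilizer and the branch structure

namespace BasilicaGroup
variable {p : ℕ} {G : Type} [Group G] (S : BasilicaGroup p G)

theorem act_inv_of_act {g : G} (hg : ∀ x, S.act g x = x) (x : Fin p) : S.act g⁻¹ x = x := by
  conv_lhs => rw [← hg x]
  exact S.act_inv_act g x

theorem sec_inv_of_act {g : G} (hg : ∀ x, S.act g x = x) (x : Fin p) :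
    S.sec g⁻¹ x = (S.sec g x)⁻¹ := by
  rw [S.sec_inv, S.act_inv_of_act hg]

theorem sec_mul_of_act (g : G) {h : G} (hh : ∀ x, S.act h x = x) (x : Fin p) :
    S.sec (g * h) x = S.sec g x * S.sec h x := by
  rw [S.sec_mul, hh]

theorem act_conj {k : G} (g : G) (hk : ∀ x, S.act k x = x) (x : Fin p) :
    S.act (g * k * g⁻¹) x = x := by
  simp [hk]

theorem sec_conj {k : G} (g : G) (hk : ∀ x, S.act k x = x) (x : Fin p) :
    S.sec (g * k * g⁻¹) (S.act g x) = S.sec g x * S.sec k x * (S.sec g x)⁻¹ := by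
  simp [hk, S.sec_inv]

theorem act_comm {g h : G} (hg : ∀ x, S.act g x = x) (hh : ∀ x, S.act h x = x) (x : Fin p) :
    S.act ⁅g, h⁆ x = x := by
  simp [commutatorElement_def, hg, hh, S.act_inv_of_act]

theorem sec_comm {g h : G} (hg : ∀ x, S.act g x = x) (hh : ∀ x, S.act h x = x) (x : Fin p) :
    S.sec ⁅g, h⁆ x = ⁅S.sec g x, S.sec h x⁆ := by
  simp [commutatorElement_def, hg, hh, S.act_inv_of_act, S.sec_inv]

/-- The elements that fix the letters and have all their sections in `K`. -/
def lift (K : Subgroup G) : Subgroup G where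
  carrier := {g | (∀ x, S.act g x = x) ∧ ∀ x, S.sec g x ∈ K}
  one_mem' := by simp
  mul_mem' := by
    rintro g h ⟨h1, h2⟩ ⟨k1, k2⟩
    exact ⟨fun x => by simp [h1, k1], fun x => by
      rw [S.sec_mul_of_act g k1]; exact K.mul_mem (h2 x) (k2 x)⟩
  inv_mem' := by
    rintro g ⟨h1, h2⟩
    exact ⟨S.act_inv_of_act h1, fun x => by rw [S.sec_inv_of_act h1]; exact K.inv_mem (h2 x)⟩

theorem mem_lift {K : Subgroup G} {g : G} :
    g ∈ S.lift K ↔ (∀ x, S.act g x = x) ∧ ∀ x, S.sec g x ∈ K := Iff.rfl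

theorem lift_mono : Monotone S.lift := fun _ _ h _ hg => ⟨hg.1, fun x => h (hg.2 x)⟩

instance lift_normal (K : Subgroup G) [hK : K.Normal] : (S.lift K).Normal := by
  refine ⟨fun k hk g => ⟨S.act_conj g hk.1, fun x => ?_⟩⟩
  have h := S.sec_conj g hk.1 (S.act g⁻¹ x)
  rw [S.act_act_inv] at h
  rw [h]
  exact hK.conj_mem _ (hk.2 _) _

/-- The section at `x`, as a homomorphism on the stabilizer of the letters. -/
def secHom (x : Fin p) : S.lift ⊤ →* G where
  toFun g := S.sec g x
  map_one' := S.sec_one x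
  map_mul' g h := S.sec_mul_of_act g h.2.1 x

theorem sec_zpow {g : G} (hg : ∀ x, S.act g x = x) (n : ℤ) (x : Fin p) :
    S.sec (g ^ n) x = S.sec g x ^ n :=
  map_zpow (S.secHom x) ⟨g, hg, fun _ => Subgroup.mem_top _⟩ n

theorem iterate_lift_normal (K : Subgroup G) [K.Normal] (n : ℕ) : (S.lift^[n] K).Normal := by
  induction n with
  | zero => assumption
  | succ n ih =>
    rw [Function.iterate_succ_apply']
    infer_instance

theorem act_b_pow {x : Fin p} {k : ℕ} (h : (x : ℕ) + k < p) :
    (S.act (S.b ^ k) x : ℕ) = x + k ∧ S.sec (S.b ^ k) x = 1 := by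
  induction k with
  | zero => simp
  | succ k ih =>
    obtain ⟨h1, h2⟩ := ih (by omega)
    have hne : (x : ℕ) + k + 1 ≠ p := by omega
    rw [pow_succ', S.act_mul, S.sec_mul, S.act_b, S.sec_b, h1, h2, if_neg hne, if_neg hne]
    simp [add_assoc]

/-- A full turn through the `p` letters passes the last letter exactly once. -/
theorem sec_b_pow_p (x : Fin p) : S.sec (S.b ^ p) x = S.a := by
  have hx := x.isLt
  have e : S.b ^ p = S.b ^ (x : ℕ) * S.b * S.b ^ (p - 1 - x) := by
    rw [← pow_succ, ← pow_add]
    congr 1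
    omega
  obtain ⟨h1, h2⟩ := S.act_b_pow (x := x) (k := p - 1 - x) (by omega)
  have hl : (S.act (S.b ^ (p - 1 - (x : ℕ))) x : ℕ) + 1 = p := by omega
  have h0 : (S.act S.b (S.act (S.b ^ (p - 1 - (x : ℕ))) x) : ℕ) = 0 := by
    rw [S.act_b, if_pos hl]
  obtain ⟨-, h3⟩ := S.act_b_pow (x := S.act S.b (S.act (S.b ^ (p - 1 - (x : ℕ))) x)) (k := x)
    (by omega)
  rw [e, S.sec_mul, S.sec_mul, h2, h3, S.sec_b, if_pos hl]
  simp

/-- Conjugate `a` by the power of `b` that carries `x` to the last letter without a carry, so that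
the conjugation leaves the section `b` unchanged. -/
theorem exists_single_b (x : Fin p) :
    ∃ k, (∀ y, S.act k y = y) ∧ S.sec k = Pi.mulSingle x S.b := by
  have hx := x.isLt
  set g := S.b ^ (p - 1 - (x : ℕ)) with hg
  obtain ⟨h1, h2⟩ := S.act_b_pow (x := x) (k := p - 1 - x) (by omega)
  rw [← hg] at h1 h2
  refine ⟨g⁻¹ * S.a * g, fun y => by simp, ?_⟩
  funext y
  rw [S.sec_mul, S.sec_mul, S.act_a, S.sec_inv, S.act_inv_act, S.sec_a]
  by_cases hy : y = x
  · subst hy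
    rw [if_pos (by omega), h2, Pi.mulSingle_eq_same]
    simp
  · have : (S.act g y : ℕ) + 1 ≠ p := by
      intro h
      exact hy ((S.actEquiv g).injective (Fin.ext (by simp; omega)))
    rw [if_neg this, Pi.mulSingle_eq_of_ne hy]
    simp

variable [Fact p.Prime]

theorem act_b_pow_p (x : Fin p) : S.act (S.b ^ p) x = x := by
  rw [S.act_eq_self_iff]
  simp

theorem exists_sec_eq (g : G) (x : Fin p) : ∃ k, (∀ y, S.act k y = y) ∧ S.sec k x = g := by
  refine S.induction_gen (P := fun g => ∃ k, (∀ y, S.act k y = y) ∧ S.sec k x = g)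
    ⟨_, S.act_b_pow_p, S.sec_b_pow_p x⟩ ?_ ⟨1, by simp⟩ ?_ ?_ g
  · obtain ⟨k, h1, h2⟩ := S.exists_single_b x
    exact ⟨k, h1, by simp [h2]⟩
  · rintro g h ⟨k, h1, rfl⟩ ⟨l, k1, rfl⟩
    exact ⟨k * l, fun y => by simp [h1, k1], S.sec_mul_of_act k k1 x⟩
  · rintro g ⟨k, h1, rfl⟩
    exact ⟨k⁻¹, S.act_inv_of_act h1, S.sec_inv_of_act h1 x⟩

/-- The subgroup of the elements with vanishing exponents, that is, the commutator subgroup. -/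
noncomputable def expKer : Subgroup G := S.expHom.ker

instance : S.expKer.Normal := inferInstanceAs S.expHom.ker.Normal

theorem mem_expKer {g : G} : g ∈ S.expKer ↔ S.α g = 0 ∧ S.β g = 0 := by
  rw [expKer, MonoidHom.mem_ker, ← toAdd_eq_zero, Prod.ext_iff]
  rfl

theorem exp_eq_mod {N : Subgroup G} [N.Normal] (h : ⁅S.a, S.b⁆ ∈ N) (g : G) :
    (g : G ⧸ N) = (S.a : G ⧸ N) ^ S.α g * (S.b : G ⧸ N) ^ S.β g := by
  have hc : Commute (S.a : G ⧸ N) (S.b : G ⧸ N) := by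
    rw [← commutatorElement_eq_one_iff_commute]
    exact (QuotientGroup.eq_one_iff _).mpr h
  refine S.induction_gen (P := fun g =>
    (g : G ⧸ N) = (S.a : G ⧸ N) ^ S.α g * (S.b : G ⧸ N) ^ S.β g) (by simp) (by simp) (by simp)
    ?_ ?_ g
  · intro g h hg hh
    rw [QuotientGroup.mk_mul, hg, hh, S.α_mul, S.β_mul, zpow_add, zpow_add, mul_assoc, mul_assoc,
      ← mul_assoc _ (_ ^ S.α h), (hc.zpow_zpow (S.α h) (S.β g)).symm.eq, mul_assoc]
  · intro g hg
    rw [QuotientGroup.mk_inv, hg, S.α_inv, S.β_inv, mul_inv_rev, zpow_neg, zpow_neg,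
      ← (hc.zpow_zpow (S.α g) (S.β g)).inv_inv.eq]

/-- Modulo `N` the generators commute, so exponents determine the class of an element. -/
theorem expKer_le {N : Subgroup G} [N.Normal] (h : ⁅S.a, S.b⁆ ∈ N) : S.expKer ≤ N := by
  intro g hg
  obtain ⟨h1, h2⟩ := S.mem_expKer.mp hg
  rw [← QuotientGroup.eq_one_iff, S.exp_eq_mod h, h1, h2]
  simp

/-- The elements that occur at the letter `x` of an element with no other sections. -/
def singles (x : Fin p) : Subgroup G where
  carrier := {h | ∃ k, (∀ y, S.act k y = y) ∧ S.sec k = Pi.mulSingle x h}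
  one_mem' := ⟨1, by simp, by funext y; simp⟩
  mul_mem' := by
    rintro g h ⟨k, h1, h2⟩ ⟨l, k1, k2⟩
    refine ⟨k * l, fun y => by simp [h1, k1], funext fun y => ?_⟩
    rw [S.sec_mul_of_act k k1, h2, k2, Pi.mulSingle_mul, Pi.mul_apply]
  inv_mem' := by
    rintro g ⟨k, h1, h2⟩
    refine ⟨k⁻¹, S.act_inv_of_act h1, funext fun y => ?_⟩
    rw [S.sec_inv_of_act h1, h2, Pi.mulSingle_inv, Pi.inv_apply]

instance (x : Fin p) : (S.singles x).Normal := by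
  refine ⟨fun h hh g => ?_⟩
  obtain ⟨k, h1, h2⟩ := hh
  obtain ⟨l, k1, rfl⟩ := S.exists_sec_eq g x
  refine ⟨l * k * l⁻¹, S.act_conj l h1, funext fun y => ?_⟩
  have h := S.sec_conj l h1 y
  rw [k1] at h
  rw [h, h2]
  by_cases hy : y = x
  · subst hy
    simp
  · simp [hy]

/-- The normal subgroup `singles x` contains `b`, and it contains `⁅a, b⁆` because `b ^ p` has all
sections equal to `a`. Hence it contains `expKer`, and `h` differs from an element of `expKer` by a
power of `b`. -/
theorem mem_singles {h : G} (hh : S.α h = 0) (x : Fin p) : h ∈ S.singles x := by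
  have hb : S.b ∈ S.singles x := S.exists_single_b x
  have hc : ⁅S.a, S.b⁆ ∈ S.singles x := by
    obtain ⟨k, h1, h2⟩ := S.exists_single_b x
    refine ⟨⁅S.b ^ p, k⁆, S.act_comm S.act_b_pow_p h1, funext fun y => ?_⟩
    rw [S.sec_comm S.act_b_pow_p h1, h2, S.sec_b_pow_p]
    by_cases hy : y = x
    · subst hy
      simp
    · simp [hy]
  have := S.expKer_le hc (S.mem_expKer.mpr ⟨by simpa using hh, by simp⟩ :
    h * S.b ^ (-S.β h) ∈ S.expKer)
  exact ((S.singles x).mul_mem_cancel_right ((S.singles x).zpow_mem hb _)).mp this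

/-- Converse to `α_sec_of_act`: a power of `b ^ p` produces the common value `m`, and what is left
has `α = 0` at each letter and is a product of singles. -/
theorem exists_sec_eq_fun {f : Fin p → G} {m : ℤ} (hf : ∀ x, S.α (f x) = m) :
    ∃ g, (∀ x, S.act g x = x) ∧ S.sec g = f := by
  have key : ∀ s : Finset (Fin p), ∀ f : Fin p → G, (∀ x, S.α (f x) = 0) →
      (∀ x, x ∉ s → f x = 1) → ∃ g, (∀ x, S.act g x = x) ∧ S.sec g = f := by
    intro s
    induction s using Finset.induction_on with
    | empty => exact fun f _ h => ⟨1, by simp, funext fun x => by simp [h x]⟩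
    | insert y s _ ih =>
      intro f h0 h1
      obtain ⟨k, k1, k2⟩ := S.mem_singles (h0 y) y
      obtain ⟨l, l1, l2⟩ := ih (f * (Pi.mulSingle y (f y))⁻¹)
        (fun x => by
          by_cases hx : x = y
          · subst hx; simp
          · simp [hx, h0])
        (fun x hx => by
          by_cases hxy : x = y
          · subst hxy; simp
          · simp [hxy, h1 x (by simp [hx, hxy])])
      refine ⟨l * k, fun x => by simp [k1, l1], funext fun x => ?_⟩
      rw [S.sec_mul_of_act l k1, l2, k2]
      simp
  obtain ⟨g, h1, h2⟩ := key Finset.univ (fun x => S.a ^ (-m) * f x) (by simp [hf]) (by simp)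
  have hp : ∀ x, S.act ((S.b ^ p) ^ m) x = x := fun x => by rw [S.act_eq_self_iff]; simp
  have hs : ∀ x, S.sec ((S.b ^ p) ^ m) x = S.a ^ m := fun x => by
    rw [S.sec_zpow S.act_b_pow_p, S.sec_b_pow_p]
  refine ⟨(S.b ^ p) ^ m * g, fun x => by rw [S.act_mul, h1, hp], funext fun x => ?_⟩
  rw [S.sec_mul_of_act _ h1, h2, hs]
  simp

/-- The element with section `h` at `x` and no other sections, if there is one. -/
noncomputable def single (x : Fin p) (h : G) : G :=
  open Classical in if hh : h ∈ S.singles x then hh.choose else 1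

theorem act_single {h : G} (hh : S.α h = 0) (x y : Fin p) : S.act (S.single x h) y = y := by
  rw [single, dif_pos (S.mem_singles hh x)]
  exact (S.mem_singles hh x).choose_spec.1 y

theorem sec_single {h : G} (hh : S.α h = 0) (x : Fin p) :
    S.sec (S.single x h) = Pi.mulSingle x h := by
  rw [single, dif_pos (S.mem_singles hh x)]
  exact (S.mem_singles hh x).choose_spec.2

theorem eq_single {h k : G} {x : Fin p} (h1 : ∀ y, S.act k y = y) (h2 : S.sec k = Pi.mulSingle x h)
    (hh : S.α h = 0) : k = S.single x h :=
  S.ext_sec (fun y => by rw [h1, S.act_single hh]) fun y => by rw [h2, S.sec_single hh]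

theorem single_mem_expKer {h : G} (hh : h ∈ S.expKer) (x : Fin p) :
    S.single x h ∈ S.expKer := by
  obtain ⟨h1, h2⟩ := S.mem_expKer.mp hh
  refine S.mem_expKer.mpr ⟨?_, ?_⟩
  · rw [← S.sum_β_sec, S.sec_single h1]
    refine Finset.sum_eq_zero fun y _ => ?_
    by_cases hy : y = x
    · subst hy; simpa
    · simp [hy]
  · rw [← S.α_sec_of_act (S.act_single h1 x x), S.sec_single h1, Pi.mulSingle_eq_same, h1, mul_zero]

theorem single_mul {g h : G} (hg : S.α g = 0) (hh : S.α h = 0) (x : Fin p) :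
    S.single x (g * h) = S.single x g * S.single x h := by
  symm
  refine S.eq_single (fun y => ?_) (funext fun y => ?_) (by simp [hg, hh])
  · rw [S.act_mul, S.act_single hh, S.act_single hg]
  · rw [S.sec_mul_of_act _ (S.act_single hh x), S.sec_single hg, S.sec_single hh,
      Pi.mulSingle_mul, Pi.mul_apply]

theorem single_one (x : Fin p) : S.single x (1 : G) = 1 :=
  (S.eq_single (by simp) (funext fun y => by simp) (by simp)).symm

theorem single_inv {h : G} (hh : S.α h = 0) (x : Fin p) :
    S.single x h⁻¹ = (S.single x h)⁻¹ := by
  rw [eq_inv_iff_mul_eq_one, ← S.single_mul (by simpa) hh, inv_mul_cancel, S.single_one]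

theorem single_comm {g h : G} (hg : S.α g = 0) (hh : S.α h = 0) (x : Fin p) :
    S.single x ⁅g, h⁆ = ⁅S.single x g, S.single x h⁆ := by
  simp [commutatorElement_def, S.single_mul, S.single_inv, hg, hh]

theorem single_conj {h : G} (hh : S.α h = 0) (g : G) (x : Fin p) :
    g * S.single x h * g⁻¹ = S.single (S.act g x) (S.sec g x * h * (S.sec g x)⁻¹) := by
  refine S.eq_single (S.act_conj g (S.act_single hh x)) (funext fun y => ?_) (by simp [hh])
  obtain ⟨z, rfl⟩ := (S.actEquiv g).surjective y
  rw [S.actEquiv_apply, S.sec_conj g (S.act_single hh x), S.sec_single hh]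
  by_cases hz : z = x
  · subst hz; simp
  · have : S.act g z ≠ S.act g x := (S.actEquiv g).injective.ne hz
    simp [hz, this]

theorem single_injective {h : G} (hh : S.α h = 0) {x : Fin p} (h1 : S.single x h = 1) : h = 1 := by
  have := congrFun (S.sec_single hh x) x
  rw [h1] at this
  simpa using this.symm

theorem lift_le_of_single {K W : Subgroup G} (hK : ∀ h ∈ K, S.α h = 0)
    (h : ∀ x, ∀ k ∈ K, S.single x k ∈ W) : S.lift K ≤ W := by
  have key : ∀ s : Finset (Fin p), ∀ g ∈ S.lift K, (∀ x, x ∉ s → S.sec g x = 1) → g ∈ W := by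
    intro s
    induction s using Finset.induction_on with
    | empty =>
      intro g hg h1
      rw [S.eq_one_of_sec hg.1 fun x => h1 x (by simp)]
      exact W.one_mem
    | insert y s _ ih =>
      intro g hg h1
      have h0 := hK _ (hg.2 y)
      have hs : S.single y (S.sec g y) ∈ S.lift K := by
        refine ⟨S.act_single h0 y, fun x => ?_⟩
        rw [S.sec_single h0]
        by_cases hx : x = y
        · subst hx; simpa using hg.2 x
        · simp [hx]
      refine (W.mul_mem_cancel_right (W.inv_mem (h y _ (hg.2 y)))).mp
        (ih _ ((S.lift K).mul_mem hg ((S.lift K).inv_mem hs)) fun x hx => ?_)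
      rw [S.sec_mul_of_act _ (S.act_inv_of_act hs.1), S.sec_inv_of_act hs.1, S.sec_single h0]
      by_cases hxy : x = y
      · subst hxy; simp
      · simp [hxy, h1 x (by simp [hx, hxy])]
  exact fun g hg => key Finset.univ g hg (by simp)

end BasilicaGroup

-- Maximal subgroups and finitely generated abelian layers

section FGAbelian

/-- `B` has a finitely generated abelian quotient whose kernel is contained in `A`. -/
def FGAbelianOver {G : Type} [Group G] (A B : Subgroup G) : Prop :=
  ∃ (Q : Type) (_ : CommGroup Q) (_ : Module.Finite ℤ (Additive Q)) (f : B →* Q),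
    ∀ x, f x = 1 → (x : G) ∈ A

theorem FGAbelianOver.mono {G : Type} [Group G] {A A' B : Subgroup G} (h : FGAbelianOver A B)
    (hA : A ≤ A') : FGAbelianOver A' B := by
  obtain ⟨Q, i, j, f, hf⟩ := h
  exact ⟨Q, i, j, f, fun x hx => hA (hf x hx)⟩

/-- `Q` is `B / (B ⊓ M)`. Maximality of `M` applied to the squares of `Q` leaves two cases, `Q² = 1`
and `Q² = Q`; a finitely generated abelian group is finite in both. Its elements then represent all
cosets of `M`. -/
theorem IsCoatom.finiteIndex_of_surjective {G : Type} [Group G] {M B : Subgroup G} (hM : IsCoatom M)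
    [hB : B.Normal] (hBM : ¬ B ≤ M) {Q : Type} [CommGroup Q] [Module.Finite ℤ (Additive Q)]
    {f : B →* Q} (hf : Function.Surjective f) (hker : ∀ x, f x = 1 ↔ (x : G) ∈ M) :
    M.FiniteIndex := by
  have htop : B ⊔ M = ⊤ := hM.2 _ (right_lt_sup.mpr hBM)
  have hdec : ∀ g : G, ∃ b ∈ B, ∃ m ∈ M, b * m = g := fun g =>
    Subgroup.mem_sup_of_normal_left.mp (htop ▸ Subgroup.mem_top g)
  -- `B ⊓ M` is normal in `G = B M`: `M` normalizes it, and so does `B` because `Q` is abelian.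
  have hconj : ∀ g c : G, c ∈ M → c ∈ B → g * c * g⁻¹ ∈ M := by
    intro g c hc hcB
    obtain ⟨b, hb, m, hm, rfl⟩ := hdec g
    have h1 : m * c * m⁻¹ ∈ B := hB.conj_mem _ hcB _
    have h2 : f ⟨m * c * m⁻¹, h1⟩ = 1 :=
      (hker _).mpr (M.mul_mem (M.mul_mem hm hc) (M.inv_mem hm))
    have h3 := (hker (⟨b, hb⟩ * ⟨m * c * m⁻¹, h1⟩ * ⟨b, hb⟩⁻¹)).mp
      (by rw [map_mul, map_mul, h2, mul_one, map_inv, mul_inv_cancel])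
    simpa [mul_assoc] using h3
  -- The preimage of the squares of `Q`; squares are preserved by the action of `G` on `Q`, so `D`
  -- is normal in `G`.
  let D : Subgroup G := (((powMonoidHom 2 : Q →* Q).range).comap f).map B.subtype
  have hmemD : ∀ x : B, (x : G) ∈ D ↔ ∃ q, q ^ 2 = f x := by
    intro x
    simp [D]
  have hDB : D ≤ B := by
    rintro _ ⟨x, -, rfl⟩
    exact x.2
  have hDn : D.Normal := by
    refine ⟨fun d hd g => ?_⟩
    have hdB := hDB hd
    obtain ⟨q, hq⟩ := (hmemD ⟨d, hdB⟩).mp hd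
    obtain ⟨y, rfl⟩ := hf q
    have hc : f (⟨d, hdB⟩ * (y ^ 2)⁻¹) = 1 := by
      rw [map_mul, ← hq]
      simp
    have hc2 := hconj g _ ((hker _).mp hc) (Subtype.prop _)
    set c : B := ⟨d, hdB⟩ * (y ^ 2)⁻¹ with hcdef
    have hd' : d = c * (y : G) ^ 2 := by simp [hcdef]
    let c' : B := ⟨g * c * g⁻¹, hB.conj_mem _ c.2 _⟩
    let y' : B := ⟨g * y * g⁻¹, hB.conj_mem _ y.2 _⟩
    have he : g * d * g⁻¹ = ((c' * y' ^ 2 : B) : G) := by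
      simp [c', y', hd', conj_pow]
    rw [he, hmemD]
    refine ⟨f y', ?_⟩
    rw [map_mul, map_pow, (hker c').mpr hc2, one_mul]
  have hfin : Finite Q := by
    have htors : Module.IsTorsion ℤ (Additive Q) := by
      by_cases hDM : D ≤ M
      · intro q
        refine ⟨⟨2, mem_nonZeroDivisors_of_ne_zero two_ne_zero⟩, ?_⟩
        obtain ⟨x, hx⟩ := hf q.toMul
        have h1 : ((x ^ 2 : B) : G) ∈ D := (hmemD _).mpr ⟨f x, by simp⟩
        have h2 := (hker _).mpr (hDM h1)
        rw [map_pow, hx] at h2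
        have h3 : (2 : ℕ) • q = 0 := Additive.toMul.injective (by simpa using h2)
        have h4 : (2 : ℤ) • q = 0 := by exact_mod_cast h3
        exact h4
      · have htop' : D ⊔ M = ⊤ := hM.2 _ (right_lt_sup.mpr hDM)
        have hsq : ∀ q : Q, ∃ r : Q, r ^ 2 = q := by
          intro q
          obtain ⟨x, rfl⟩ := hf q
          obtain ⟨d, hd, m, hm, hdm⟩ :=
            Subgroup.mem_sup_of_normal_left.mp (htop' ▸ Subgroup.mem_top (x : G))
          obtain ⟨r, hr⟩ := (hmemD ⟨d, hDB hd⟩).mp hd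
          refine ⟨r, ?_⟩
          have hm' : ((⟨d, hDB hd⟩⁻¹ * x : B) : G) ∈ M := by
            simpa [← hdm] using hm
          have := (hker _).mpr hm'
          rw [map_mul, map_inv, inv_mul_eq_one] at this
          rw [hr, this]
        -- Nakayama for `2Q = Q`: some `r ≡ 1` mod `2`, hence nonzero, kills `Q`.
        obtain ⟨r, hr1, hr2⟩ :=
          Submodule.exists_sub_one_mem_and_smul_eq_zero_of_fg_of_le_smul (Ideal.span {(2 : ℤ)})
            (⊤ : Submodule ℤ (Additive Q)) Module.Finite.fg_top (by
              intro q _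
              obtain ⟨r, hr⟩ := hsq q.toMul
              have : q = (2 : ℤ) • Additive.ofMul r := by
                apply Additive.toMul.injective
                rw [← hr]
                simp
              rw [this]
              exact Submodule.smul_mem_smul (Ideal.mem_span_singleton_self _) trivial)
        have hr0 : r ≠ 0 := by
          rintro rfl
          rw [Ideal.mem_span_singleton] at hr1
          omega
        intro q
        exact ⟨⟨r, mem_nonZeroDivisors_of_ne_zero hr0⟩, hr2 q trivial⟩
    exact Module.finite_of_fg_torsion (Additive Q) htors
  have hfin2 : Finite (G ⧸ M) := by
    refine Finite.of_surjective (fun q : Q => ((Function.surjInv hf q : B) : G ⧸ M)) fun y => ?_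
    induction y using QuotientGroup.induction_on with
    | H g =>
      obtain ⟨b, hb, m, hm, rfl⟩ := hdec g
      refine ⟨f ⟨b, hb⟩, ?_⟩
      have h1 : f ((Function.surjInv hf (f ⟨b, hb⟩))⁻¹ * ⟨b, hb⟩) = 1 := by
        rw [map_mul, map_inv, Function.surjInv_eq hf, inv_mul_cancel]
      have h2 := (hker _).mp h1
      rw [QuotientGroup.eq, ← mul_assoc]
      exact M.mul_mem h2 hm
  exact Subgroup.finiteIndex_of_finite_quotient

/-- Dividing `Q` by the image of `M ⊓ B` makes the kernel exactly `M ⊓ B`. -/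
theorem IsCoatom.le_or_finiteIndex {G : Type} [Group G] {M B : Subgroup G} (hM : IsCoatom M)
    [hB : B.Normal] (h : FGAbelianOver M B) : B ≤ M ∨ M.FiniteIndex := by
  by_cases hBM : B ≤ M
  · exact Or.inl hBM
  right
  obtain ⟨Q, _, _, f, hf⟩ := h
  let R : Subgroup Q := (M.subgroupOf B).map f
  let g : B →* Q ⧸ R := (QuotientGroup.mk' R).comp f
  have h1 : Module.Finite ℤ (Additive (Q ⧸ R)) :=
    Module.Finite.of_surjective (MonoidHom.toAdditive (QuotientGroup.mk' R)).toIntLinearMap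
      fun q => by
        obtain ⟨x, hx⟩ := QuotientGroup.mk'_surjective R q.toMul
        exact ⟨Additive.ofMul x, congrArg Additive.ofMul hx⟩
  have h2 : Module.Finite ℤ (Additive g.range) :=
    Module.Finite.of_injective g.range.subtype.toAdditive.toIntLinearMap
      fun x y h => Additive.toMul.injective (Subtype.ext (congrArg Additive.toMul h))
  refine hM.finiteIndex_of_surjective hBM (f := g.rangeRestrict) g.rangeRestrict_surjective
    fun x => ?_
  rw [← Subtype.coe_inj, MonoidHom.coe_rangeRestrict, OneMemClass.coe_one]
  change ((f x : Q) : Q ⧸ R) = 1 ↔ _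
  rw [QuotientGroup.eq_one_iff]
  constructor
  · rintro ⟨y, hy, hxy⟩
    have := hf (y⁻¹ * x) (by rw [map_mul, map_inv, hxy, inv_mul_cancel])
    rw [Subgroup.coe_mul] at this
    exact (M.mul_mem_cancel_left (M.inv_mem hy)).mp this
  · exact fun hx => ⟨x, hx, rfl⟩

theorem finite_int_pi {ι Q : Type} [Finite ι] [CommGroup Q] [Module.Finite ℤ (Additive Q)] :
    Module.Finite ℤ (Additive (ι → Q)) :=
  Module.Finite.of_surjective
    (AddMonoidHom.toIntLinearMap
      { toFun := fun q : ι → Additive Q => (Additive.ofMul fun i => (q i).toMul)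
        map_zero' := rfl
        map_add' := fun _ _ => rfl })
    fun q => ⟨fun i => Additive.ofMul (q.toMul i), rfl⟩

end FGAbelian

-- Abelian layers and finite index under `lift`

namespace BasilicaGroup
variable {p : ℕ} {G : Type} [Group G] (S : BasilicaGroup p G)

theorem fgAbelianOver_lift {A B : Subgroup G} (h : FGAbelianOver A B) :
    FGAbelianOver (S.lift A) (S.lift B) := by
  obtain ⟨Q, _, _, f, hf⟩ := h
  refine ⟨Fin p → Q, inferInstance, finite_int_pi,
    { toFun := fun g x => f ⟨S.sec g x, g.2.2 x⟩
      map_one' := ?_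
      map_mul' := ?_ }, ?_⟩
  · funext x
    have : (⟨S.sec ((1 : S.lift B) : G) x, (1 : S.lift B).2.2 x⟩ : B) = 1 :=
      Subtype.ext (S.sec_one x)
    simp only [this, map_one, Pi.one_apply]
  · intro g h
    funext x
    rw [Pi.mul_apply, ← map_mul]
    exact congrArg f (Subtype.ext (S.sec_mul_of_act g h.2.1 x))
  · intro g hg
    exact ⟨g.2.1, fun x => hf _ (congrFun hg x)⟩

theorem fgAbelianOver_iterate_lift {A B : Subgroup G} (h : FGAbelianOver A B) (n : ℕ) :
    FGAbelianOver (S.lift^[n] A) (S.lift^[n] B) := by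
  induction n with
  | zero => exact h
  | succ n ih =>
    rw [Function.iterate_succ_apply', Function.iterate_succ_apply']
    exact S.fgAbelianOver_lift ih

theorem finiteIndex_lift {K : Subgroup G} (hK : K.FiniteIndex) : (S.lift K).FiniteIndex := by
  let π : G →* Equiv.Perm (Fin p) := MonoidHom.mk' S.actEquiv fun g h => by
    ext x
    simp
  have h1 : (S.lift ⊤).FiniteIndex := by
    refine Subgroup.finiteIndex_of_le (H := π.ker) fun g hg => ⟨fun x => ?_, fun _ => trivial⟩
    exact congrArg (fun e : Equiv.Perm (Fin p) => e x) hg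
  have h2 : (⨅ x, K.comap (S.secHom x)).FiniteIndex :=
    Subgroup.finiteIndex_iInf fun x => ⟨by
      rw [Subgroup.index_comap]
      exact (inferInstance : (K.subgroupOf (S.secHom x).range).FiniteIndex).index_ne_zero⟩
  have h3 : ((⨅ x, K.comap (S.secHom x)).map (S.lift ⊤).subtype).FiniteIndex := by
    refine ⟨?_⟩
    rw [Subgroup.index_map_subtype]
    exact mul_ne_zero h2.index_ne_zero h1.index_ne_zero
  refine Subgroup.finiteIndex_of_le (H := (⨅ x, K.comap (S.secHom x)).map (S.lift ⊤).subtype) ?_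
  rintro _ ⟨g, hg, rfl⟩
  exact ⟨g.2.1, fun x => (Subgroup.mem_iInf.mp hg) x⟩

theorem finiteIndex_iterate_lift (n : ℕ) : (S.lift^[n] ⊤).FiniteIndex := by
  induction n with
  | zero => exact inferInstanceAs (⊤ : Subgroup G).FiniteIndex
  | succ n ih =>
    rw [Function.iterate_succ_apply']
    exact S.finiteIndex_lift ih

end BasilicaGroup

-- Finite generation of `expKer` modulo its derived subgroup

namespace BasilicaGroup
variable {p : ℕ} {G : Type} [Group G] (S : BasilicaGroup p G) [Fact p.Prime]

theorem α_of_mem {h : G} (hh : h ∈ S.expKer) : S.α h = 0 := (S.mem_expKer.mp hh).1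

theorem comm_le_expKer : ⁅S.expKer, S.expKer⁆ ≤ S.expKer := Subgroup.commutator_le_left _ _

/-- The elements `h` with vanishing exponents such that `single x h` lies in `V`. -/
noncomputable def comapSingle (V : Subgroup G) (x : Fin p) : Subgroup G where
  carrier := {h | h ∈ S.expKer ∧ S.single x h ∈ V}
  one_mem' := ⟨S.expKer.one_mem, by rw [S.single_one]; exact V.one_mem⟩
  mul_mem' := by
    rintro g h ⟨g1, g2⟩ ⟨h1, h2⟩
    refine ⟨S.expKer.mul_mem g1 h1, ?_⟩
    rw [S.single_mul (S.α_of_mem g1) (S.α_of_mem h1)]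
    exact V.mul_mem g2 h2
  inv_mem' := by
    rintro g ⟨g1, g2⟩
    refine ⟨S.expKer.inv_mem g1, ?_⟩
    rw [S.single_inv (S.α_of_mem g1)]
    exact V.inv_mem g2

instance comapSingle_normal (V : Subgroup G) [hV : V.Normal] (x : Fin p) :
    (S.comapSingle V x).Normal := by
  refine ⟨fun h hh g => ?_⟩
  obtain ⟨k, k1, rfl⟩ := S.exists_sec_eq g x
  refine ⟨Subgroup.Normal.conj_mem inferInstance _ hh.1 _, ?_⟩
  have := S.single_conj (S.α_of_mem hh.1) k x
  rw [k1] at this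
  rw [← this]
  exact hV.conj_mem _ hh.2 _

theorem exists_act_eq (x y : Fin p) : ∃ g, S.act g x = y := by
  have h0 : 0 < p := (Fact.out : p.Prime).pos
  have key : ∀ y : Fin p, S.act (S.b ^ (y : ℕ)) ⟨0, h0⟩ = y := fun y => Fin.ext (by
    rw [(S.act_b_pow (x := ⟨0, h0⟩) (k := y) (by simp)).1]
    simp)
  refine ⟨S.b ^ (y : ℕ) * (S.b ^ (x : ℕ))⁻¹, ?_⟩
  rw [S.act_mul]
  have h : S.act (S.b ^ (x : ℕ))⁻¹ x = ⟨0, h0⟩ := by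
    have := S.act_inv_act (S.b ^ (x : ℕ)) ⟨0, h0⟩
    rwa [key] at this
  rw [h, key]

theorem lift_le_of_le_comapSingle {V K : Subgroup G} [hV : V.Normal] [hK : K.Normal] {x : Fin p}
    (h : K ≤ S.comapSingle V x) : S.lift K ≤ V := by
  refine S.lift_le_of_single (fun k hk => S.α_of_mem (h hk).1) fun y k hk => ?_
  obtain ⟨g, rfl⟩ := S.exists_act_eq x y
  have hk' := hK.conj_mem _ hk (S.sec g x)⁻¹
  have := S.single_conj (S.α_of_mem (h hk').1) g x
  rw [show S.sec g x * ((S.sec g x)⁻¹ * k * (S.sec g x)⁻¹⁻¹) * (S.sec g x)⁻¹ = k by group] at this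
  rw [← this]
  exact hV.conj_mem _ (h hk').2 _

theorem single_commute {g h : G} (hg : S.α g = 0) (hh : S.α h = 0) {x y : Fin p} (hxy : x ≠ y) :
    Commute (S.single x g) (S.single y h) := by
  refine S.ext_sec (fun z => ?_) fun z => ?_
  · simp [S.act_single, hg, hh]
  · rw [S.sec_mul_of_act _ (S.act_single hh y), S.sec_mul_of_act _ (S.act_single hg x),
      S.sec_single hg, S.sec_single hh]
    by_cases hz : z = x
    · subst hz; simp [hxy]
    · simp [hz]

/-- `a` has its only nontrivial section at the last letter and `b a b⁻¹` at the first, so they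
commute, and `⁅a, b⁆ = a (b a b⁻¹)⁻¹`. -/
theorem commute_a_comm : Commute S.a ⁅S.a, S.b⁆ := by
  have hp : 2 ≤ p := (Fact.out : p.Prime).two_le
  let l : Fin p := ⟨p - 1, by omega⟩
  have hl : (l : ℕ) + 1 = p := by simp only [l]; omega
  have ha : S.a = S.single l S.b := by
    refine S.eq_single S.act_a (funext fun y => ?_) S.α_b
    rw [S.sec_a]
    by_cases hy : y = l
    · subst hy
      rw [if_pos hl, Pi.mulSingle_eq_same]
    · rw [if_neg (fun h => hy (Fin.ext (by omega))), Pi.mulSingle_eq_of_ne hy]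
  have hne : l ≠ S.act S.b l := by
    intro h
    have := congrArg Fin.val h
    rw [S.act_b, if_pos hl] at this
    omega
  have h1 : Commute S.a (S.b * S.a * S.b⁻¹) := by
    have h2 := S.single_conj S.α_b S.b l
    rw [← ha] at h2
    rw [h2]
    conv in S.a => rw [ha]
    exact S.single_commute S.α_b (by simp) hne
  have h3 : ⁅S.a, S.b⁆ = S.a * (S.b * S.a * S.b⁻¹)⁻¹ := by
    rw [commutatorElement_def]
    group
  rw [h3]
  exact (Commute.refl _).mul_right h1.inv_right

theorem comm_mem_expKer : ⁅S.a, S.b⁆ ∈ S.expKer :=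
  S.mem_expKer.mpr (by simp [commutatorElement_def])

/-- A power of `b` at a second letter compensates `β h`. -/
theorem exists_expKer_sec_eq {h : G} (hh : S.α h = 0) (x : Fin p) :
    ∃ y ∈ S.expKer, S.sec y x = h := by
  have hp : 2 ≤ p := (Fact.out : p.Prime).two_le
  have : Nontrivial (Fin p) := Fin.nontrivial_iff_two_le.mpr hp
  obtain ⟨z, hz⟩ := exists_ne x
  have hα : S.α (S.b ^ (-S.β h)) = 0 := by simp
  refine ⟨S.single x h * S.single z (S.b ^ (-S.β h)), ?_, ?_⟩
  · refine S.mem_expKer.mpr ⟨?_, ?_⟩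
    · rw [S.α_mul, ← S.sum_β_sec, ← S.sum_β_sec, S.sec_single hh, S.sec_single hα,
        Finset.sum_eq_single x, Finset.sum_eq_single z] <;> simp +contextual
    · rw [S.β_mul, ← S.α_sec_of_act (S.act_single hh x x), ← S.α_sec_of_act (S.act_single hα z x),
        S.sec_single hh, S.sec_single hα]
      simp [hh, hz.symm]
  · rw [S.sec_mul_of_act _ (S.act_single hα z), S.sec_single hh, S.sec_single hα]
    simp [hz.symm]

/-- As `a` commutes with `⁅a, b⁆`, a conjugator may be replaced by one with `α = 0`, and such an
element is a section of an element of `expKer`. -/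
theorem conj_comm_eq (g : G) : g * ⁅S.a, S.b⁆ * g⁻¹ =
    (g * S.a ^ (-S.α g)) * ⁅S.a, S.b⁆ * (g * S.a ^ (-S.α g))⁻¹ := by
  have h := (S.commute_a_comm.zpow_left (-S.α g)).eq
  rw [mul_assoc g (S.a ^ (-S.α g)), h, mul_inv_rev]
  simp only [mul_assoc, mul_inv_cancel_left]

theorem mem_expKer_of_sec_eq {g : G} {x y : Fin p} (h1 : ∀ z, S.act g z = z)
    (h2 : S.sec g = Pi.mulSingle x S.b * (Pi.mulSingle y S.b)⁻¹) : g ∈ S.expKer := by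
  refine S.mem_expKer.mpr ⟨?_, ?_⟩
  · have : ∀ x : Fin p, ∑ y, S.β ((Pi.mulSingle x S.b : Fin p → G) y) = 1 := fun x => by
      rw [Finset.sum_eq_single x] <;> simp +contextual
    rw [← S.sum_β_sec, h2]
    simp only [Pi.mul_apply, Pi.inv_apply, S.β_mul, S.β_inv, Finset.sum_add_distrib,
      Finset.sum_neg_distrib, this, add_neg_cancel]
  · rw [← S.α_sec_of_act (h1 x), h2]
    by_cases hx : x = y
    · simp [hx]
    · simp [hx]

/-- `expKer` is generated modulo its derived subgroup by finitely many explicit elements. -/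
theorem expKer_le_of_generators {V : Subgroup G} (h1 : ⁅S.expKer, S.expKer⁆ ≤ V)
    (h2 : ∀ x, S.single x ⁅S.a, S.b⁆ ∈ V) {E : Fin p → G} (x₀ : Fin p)
    (hE : ∀ x, ∀ y, S.act (E x) y = y)
    (hE2 : ∀ x, S.sec (E x) = Pi.mulSingle x S.b * (Pi.mulSingle x₀ S.b)⁻¹)
    (h3 : ∀ x, E x ∈ V) : S.expKer ≤ V := by
  have hE3 : ∀ x, E x ∈ S.expKer := fun x => S.mem_expKer_of_sec_eq (hE x) (hE2 x)
  have hc := S.α_of_mem S.comm_mem_expKer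
  have hV : ∀ x, S.expKer ≤ S.comapSingle V x := by
    intro x
    have h4 : S.expKer ≤ Subgroup.normalClosure {⁅S.a, S.b⁆} :=
      S.expKer_le (Subgroup.subset_normalClosure rfl)
    refine h4.trans ((Subgroup.closure_le _).mpr ?_)
    intro k hk
    obtain ⟨c, hc', hk⟩ := Group.mem_conjugatesOfSet_iff.mp hk
    obtain rfl : c = ⁅S.a, S.b⁆ := hc'
    obtain ⟨g, rfl⟩ := isConj_iff.mp hk
    refine ⟨Subgroup.Normal.conj_mem inferInstance _ S.comm_mem_expKer _, ?_⟩
    rw [S.conj_comm_eq]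
    obtain ⟨y, hy, hyx⟩ := S.exists_expKer_sec_eq
      (show S.α (g * S.a ^ (-S.α g)) = 0 by simp) x
    have hact : S.act y x = x := by
      rw [S.act_eq_self_iff, (S.mem_expKer.mp hy).2]
      exact dvd_zero _
    have h5 := S.single_conj hc y x
    rw [hyx, hact] at h5
    rw [← h5]
    -- Conjugation by `y ∈ expKer` does not change the class modulo the derived subgroup of
    -- `expKer`, so one `single x ⁅a, b⁆` per letter suffices.
    have h6 := h1 (Subgroup.commutator_mem_commutator hy (S.single_mem_expKer S.comm_mem_expKer x))
    have := V.mul_mem h6 (h2 x)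
    rwa [commutatorElement_def, inv_mul_cancel_right] at this
  have hlift : S.lift S.expKer ≤ V :=
    S.lift_le_of_single (fun _ => S.α_of_mem) fun x k hk => (hV x hk).2
  -- Powers of the `E y` clear the `β` of the sections away from `x₀`. The one at `x₀` then vanishes
  -- too, as the sum is `α g = 0`, and the element lies in `lift expKer`.
  have key : ∀ s : Finset (Fin p), ∀ g ∈ S.expKer,
      (∀ x, x ∉ s → x ≠ x₀ → S.β (S.sec g x) = 0) → g ∈ V := by
    intro s
    induction s using Finset.induction_on with
    | empty =>
      intro g hg h0
      obtain ⟨hα, hβ⟩ := S.mem_expKer.mp hg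
      have hact : ∀ x, S.act g x = x := fun x => by
        rw [S.act_eq_self_iff, hβ]
        exact dvd_zero _
      refine hlift ⟨hact, fun x => S.mem_expKer.mpr ⟨?_, ?_⟩⟩
      · have := S.α_sec_of_act (hact x)
        rw [hβ] at this
        exact (mul_eq_zero.mp this).resolve_left (by exact_mod_cast (Fact.out : p.Prime).ne_zero)
      · by_cases hx : x = x₀
        · subst hx
          rw [← hα, ← S.sum_β_sec g, Finset.sum_eq_single x] <;> simp +contextual [h0]
        · exact h0 x (by simp) hx
    | insert y s _ ih =>
      intro g hg h0
      by_cases hy : y = x₀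
      · exact ih g hg fun x hx hx0 => h0 x (by simp [hx, hy, hx0]) hx0
      have hz := V.zpow_mem (h3 y) (-S.β (S.sec g y))
      refine (V.mul_mem_cancel_right hz).mp
        (ih _ (S.expKer.mul_mem hg (S.expKer.zpow_mem (hE3 y) _)) fun x hx hx0 => ?_)
      have ha : ∀ x, S.act (E y ^ (-S.β (S.sec g y))) x = x := fun x => by
        rw [S.act_eq_self_iff, S.β_zpow, (S.mem_expKer.mp (hE3 y)).2]
        simp
      rw [S.sec_mul_of_act _ ha, S.sec_zpow (hE y), hE2]
      by_cases hxy : x = y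
      · subst hxy
        simp [hx0]
      · simp [hxy, hx0, h0 x (by simp [hx, hxy]) hx0]
  exact fun g hg => key Finset.univ g hg (by simp)

theorem fgAbelianOver_expKer : FGAbelianOver ⁅S.expKer, S.expKer⁆ S.expKer := by
  have hp : 0 < p := (Fact.out : p.Prime).pos
  let x₀ : Fin p := ⟨0, hp⟩
  have hex : ∀ x : Fin p, ∃ g, (∀ y, S.act g y = y) ∧
      S.sec g = Pi.mulSingle x S.b * (Pi.mulSingle x₀ S.b)⁻¹ := fun x => by
    refine S.exists_sec_eq_fun (m := 0) fun y => ?_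
    have : ∀ x y : Fin p, S.α ((Pi.mulSingle x S.b : Fin p → G) y) = 0 := fun x y => by
      by_cases h : y = x
      · subst h; simp
      · simp [h]
    simp [this]
  choose E hE hE2 using hex
  let T : Set (Abelianization S.expKer) :=
    {q | ∃ x : S.expKer, ((∃ y, (x : G) = E y) ∨ ∃ y, (x : G) = S.single y ⁅S.a, S.b⁆) ∧
      Abelianization.of x = q}
  have hT : T.Finite := by
    have h1 : ({x : S.expKer |
        (∃ y, (x : G) = E y) ∨ ∃ y, (x : G) = S.single y ⁅S.a, S.b⁆}).Finite := by
      refine Set.Finite.of_finite_image (f := Subtype.val) ?_ Subtype.val_injective.injOn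
      refine ((Set.finite_range E).union
        (Set.finite_range fun y => S.single y ⁅S.a, S.b⁆)).subset ?_
      rintro _ ⟨x, ⟨y, hy⟩ | ⟨y, hy⟩, rfl⟩
      · exact Or.inl ⟨y, hy.symm⟩
      · exact Or.inr ⟨y, hy.symm⟩
    refine (h1.image Abelianization.of).subset ?_
    rintro q ⟨x, hx, rfl⟩
    exact ⟨x, hx, rfl⟩
  have hcl : Subgroup.closure T = ⊤ := by
    have hE3 : ∀ x, E x ∈ S.expKer := fun x => S.mem_expKer_of_sec_eq (hE x) (hE2 x)
    have h := S.expKer_le_of_generators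
      (V := ((Subgroup.closure T).comap Abelianization.of).map S.expKer.subtype) (E := E) ?_ ?_ x₀
      hE hE2 ?_
    · rw [eq_top_iff]
      intro q _
      induction q using QuotientGroup.induction_on with
      | H x =>
        obtain ⟨y, hy, hyx⟩ := h x.2
        rw [← Subtype.ext hyx]
        exact hy
    · rw [← Subgroup.map_subtype_commutator]
      refine Subgroup.map_mono fun x hx => ?_
      have : Abelianization.of x = 1 := (QuotientGroup.eq_one_iff x).mpr hx
      rw [Subgroup.mem_comap, this]
      exact Subgroup.one_mem _
    · intro x
      exact ⟨⟨_, S.single_mem_expKer S.comm_mem_expKer x⟩,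
        Subgroup.subset_closure ⟨_, Or.inr ⟨x, rfl⟩, rfl⟩, rfl⟩
    · intro x
      exact ⟨⟨_, hE3 x⟩, Subgroup.subset_closure ⟨_, Or.inl ⟨x, rfl⟩, rfl⟩, rfl⟩
  have hfg : Group.FG (Abelianization S.expKer) := Group.fg_iff.mpr ⟨T, hcl, hT⟩
  refine ⟨Abelianization S.expKer, inferInstance,
    Module.Finite.iff_addGroup_fg.mpr (GroupFG.iff_add_fg.mp hfg), Abelianization.of, fun x hx => ?_⟩
  rw [← Subgroup.map_subtype_commutator]
  exact ⟨x, (QuotientGroup.eq_one_iff x).mp hx, rfl⟩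

theorem fgAbelianOver_top : FGAbelianOver S.expKer ⊤ := by
  refine ⟨Multiplicative (ℤ × ℤ), inferInstance, inferInstanceAs (Module.Finite ℤ (ℤ × ℤ)),
    S.expHom.comp (⊤ : Subgroup G).subtype, fun x hx => hx⟩

/-- A maximal subgroup that contains a large subgroup of the form `lift^[n] ⁅expKer, expKer⁆`
has finite index. -/
theorem finiteIndex_of_iterate_lift_le {M : Subgroup G} (hM : IsCoatom M) {n : ℕ}
    (h : S.lift^[n] ⁅S.expKer, S.expKer⁆ ≤ M) : M.FiniteIndex := by
  have := S.iterate_lift_normal S.expKer n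
  have := S.iterate_lift_normal ⊤ n
  -- Climb the two abelian layers up to `lift^[n] ⊤`, which has finite index.
  rcases hM.le_or_finiteIndex
    ((S.fgAbelianOver_iterate_lift S.fgAbelianOver_expKer n).mono h) with h1 | h1
  · rcases hM.le_or_finiteIndex
      ((S.fgAbelianOver_iterate_lift S.fgAbelianOver_top n).mono h1) with h2 | h2
    · have := S.finiteIndex_iterate_lift n
      exact Subgroup.finiteIndex_of_le h2
    · exact h2
  · exact h1

end BasilicaGroup

-- Nontrivial normal subgroups

namespace BasilicaGroup
variable {p : ℕ} {G : Type} [Group G] (S : BasilicaGroup p G)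

/-- The sections at `x` of the elements of `K` that fix the letters. -/
def secImage (K : Subgroup G) (x : Fin p) : Subgroup G :=
  (K.subgroupOf (S.lift ⊤)).map (S.secHom x)

theorem mem_secImage {K : Subgroup G} {x : Fin p} {h : G} :
    h ∈ S.secImage K x ↔ ∃ g ∈ K, (∀ y, S.act g y = y) ∧ S.sec g x = h := by
  constructor
  · rintro ⟨g, hg, rfl⟩
    exact ⟨g, hg, g.2.1, rfl⟩
  · rintro ⟨g, hg, h1, rfl⟩
    exact ⟨⟨g, h1, fun _ => trivial⟩, hg, rfl⟩

theorem secImage_bot (x : Fin p) : S.secImage ⊥ x = ⊥ := by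
  rw [eq_bot_iff]
  intro h hh
  obtain ⟨g, hg, -, rfl⟩ := S.mem_secImage.mp hh
  rw [Subgroup.mem_bot.mp hg, S.sec_one]
  exact Subgroup.one_mem _

theorem commutator_le_secImage {K₁ K₂ : Subgroup G} {x : Fin p} (h : K₂ ≤ S.secImage K₁ x) :
    ⁅K₂, K₂⁆ ≤ S.secImage ⁅K₁, K₁⁆ x := by
  rw [Subgroup.commutator_le]
  intro g hg k hk
  obtain ⟨g', g1, g2, rfl⟩ := S.mem_secImage.mp (h hg)
  obtain ⟨k', k1, k2, rfl⟩ := S.mem_secImage.mp (h hk)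
  exact S.mem_secImage.mpr ⟨⁅g', k'⁆, Subgroup.commutator_mem_commutator g1 k1,
    S.act_comm g2 k2, S.sec_comm g2 k2 x⟩

variable [Fact p.Prime]

/-- The subgroup of the elements with vanishing exponent of `a`. -/
noncomputable def αKer : Subgroup G where
  carrier := {g | S.α g = 0}
  one_mem' := S.α_one
  mul_mem' := by
    intro g h hg hh
    simp_all
  inv_mem' := by
    intro g hg
    simp_all

theorem αKer_le_secImage (x : Fin p) : S.αKer ≤ S.secImage S.expKer x := by
  intro h hh
  obtain ⟨y, hy, hyx⟩ := S.exists_expKer_sec_eq hh x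
  refine S.mem_secImage.mpr ⟨y, hy, fun z => ?_, hyx⟩
  rw [S.act_eq_self_iff, (S.mem_expKer.mp hy).2]
  exact dvd_zero _

theorem top_le_secImage (x : Fin p) : ⊤ ≤ S.secImage S.αKer x := by
  intro h _
  have : Nontrivial (Fin p) := Fin.nontrivial_iff_two_le.mpr (Fact.out : p.Prime).two_le
  obtain ⟨z, hz⟩ := exists_ne x
  obtain ⟨g, h1, h2⟩ := S.exists_sec_eq h x
  have hα : S.α (S.b ^ (-S.α g)) = 0 := by simp
  refine S.mem_secImage.mpr ⟨g * S.single z (S.b ^ (-S.α g)), ?_, ?_, ?_⟩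
  · change S.α _ = 0
    rw [S.α_mul, ← S.sum_β_sec (S.single _ _), S.sec_single hα, Finset.sum_eq_single z] <;>
      simp +contextual
  · intro y
    rw [S.act_mul, S.act_single hα, h1]
  · rw [S.sec_mul_of_act _ (S.act_single hα z), S.sec_single hα, h2]
    simp [hz.symm]

theorem comm_a_b_ne_one : ⁅S.a, S.b⁆ ≠ 1 := by
  intro h
  have h0 : 0 < p := (Fact.out : p.Prime).pos
  have h2 : 2 ≤ p := (Fact.out : p.Prime).two_le
  let l : Fin p := ⟨p - 1, by omega⟩
  have hl : (l : ℕ) + 1 = p := by simp only [l]; omega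
  have h1 := (commutatorElement_eq_one_iff_mul_comm.mp h)
  have h3 := congrArg (fun g => S.β (S.sec g l)) h1
  have h4 : ¬ ((S.act S.b l : ℕ) + 1 = p) := by
    rw [S.act_b, if_pos hl]
    omega
  simp only [S.sec_mul, S.sec_a, S.sec_b, S.act_a, if_pos hl, if_neg h4] at h3
  simp at h3

/-- Sections of `expKer` cover `αKer`, and sections of `αKer` cover `G`. Metabelian `expKer` would
therefore make `G` metabelian, so `expKer`, which lies in the commutator subgroup, would be abelian;
then `G` would be abelian by the same two steps. -/
theorem derived_derived_expKer_ne_bot :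
    ⁅⁅S.expKer, S.expKer⁆, ⁅S.expKer, S.expKer⁆⁆ ≠ ⊥ := by
  intro h
  let x : Fin p := ⟨0, (Fact.out : p.Prime).pos⟩
  have hL : S.expKer ≤ ⁅(⊤ : Subgroup G), (⊤ : Subgroup G)⁆ :=
    S.expKer_le (Subgroup.commutator_mem_commutator (Subgroup.mem_top _) (Subgroup.mem_top _))
  have h1 : ⁅⁅S.αKer, S.αKer⁆, ⁅S.αKer, S.αKer⁆⁆ = ⊥ := by
    have := S.commutator_le_secImage (S.commutator_le_secImage (S.αKer_le_secImage x))
    rwa [h, secImage_bot, le_bot_iff] at this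
  have h2 : ⁅⁅(⊤ : Subgroup G), (⊤ : Subgroup G)⁆, ⁅(⊤ : Subgroup G), (⊤ : Subgroup G)⁆⁆ = ⊥ := by
    have := S.commutator_le_secImage (S.commutator_le_secImage (S.top_le_secImage x))
    rwa [h1, secImage_bot, le_bot_iff] at this
  have h3 : ⁅S.expKer, S.expKer⁆ = ⊥ :=
    le_bot_iff.mp ((Subgroup.commutator_mono hL hL).trans h2.le)
  have h4 : ⁅S.αKer, S.αKer⁆ = ⊥ := by
    have := S.commutator_le_secImage (S.αKer_le_secImage x)
    rwa [h3, secImage_bot, le_bot_iff] at this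
  have h5 : ⁅(⊤ : Subgroup G), (⊤ : Subgroup G)⁆ = ⊥ := by
    have := S.commutator_le_secImage (S.top_le_secImage x)
    rwa [h4, secImage_bot, le_bot_iff] at this
  have h6 : ⁅S.a, S.b⁆ ∈ ⁅(⊤ : Subgroup G), (⊤ : Subgroup G)⁆ :=
    Subgroup.commutator_mem_commutator (Subgroup.mem_top _) (Subgroup.mem_top _)
  rw [h5] at h6
  exact S.comm_a_b_ne_one h6

theorem derived_expKer_ne_bot : ⁅S.expKer, S.expKer⁆ ≠ ⊥ := fun h =>
  S.derived_derived_expKer_ne_bot (by rw [h, Subgroup.commutator_bot_left])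

theorem lift_ne_bot {K : Subgroup G} (hK : ∀ h ∈ K, S.α h = 0) (h : K ≠ ⊥) : S.lift K ≠ ⊥ := by
  obtain ⟨k, hk, hk1⟩ := (Subgroup.bot_or_exists_ne_one K).resolve_left h
  let x : Fin p := ⟨0, (Fact.out : p.Prime).pos⟩
  have h1 : S.single x k ∈ S.lift K := by
    refine ⟨S.act_single (hK _ hk) x, fun y => ?_⟩
    rw [S.sec_single (hK _ hk)]
    by_cases hy : y = x
    · subst hy; simpa
    · simp [hy]
  intro h0
  rw [h0] at h1
  exact hk1 (S.single_injective (hK _ hk) h1)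

theorem lift_derived_le : S.lift ⁅S.expKer, S.expKer⁆ ≤ ⁅S.expKer, S.expKer⁆ := by
  refine S.lift_le_of_le_comapSingle (x := ⟨0, (Fact.out : p.Prime).pos⟩) ?_
  rw [Subgroup.commutator_le]
  intro g hg h hh
  refine ⟨S.comm_le_expKer (Subgroup.commutator_mem_commutator hg hh), ?_⟩
  rw [S.single_comm (S.α_of_mem hg) (S.α_of_mem hh)]
  exact Subgroup.commutator_mem_commutator (S.single_mem_expKer hg _) (S.single_mem_expKer hh _)

theorem iterate_lift_derived_antitone :
    Antitone fun n => S.lift^[n] ⁅S.expKer, S.expKer⁆ :=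
  antitone_nat_of_succ_le fun n => by
    rw [Function.iterate_succ_apply]
    exact S.lift_mono.iterate n S.lift_derived_le

theorem iterate_lift_derived_le (n : ℕ) :
    S.lift^[n] ⁅S.expKer, S.expKer⁆ ≤ ⁅S.expKer, S.expKer⁆ :=
  S.iterate_lift_derived_antitone (Nat.zero_le n)

theorem iterate_lift_derived_ne_bot (n : ℕ) : S.lift^[n] ⁅S.expKer, S.expKer⁆ ≠ ⊥ := by
  induction n with
  | zero => exact S.derived_expKer_ne_bot
  | succ n ih =>
    rw [Function.iterate_succ_apply']
    exact S.lift_ne_bot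
      (fun h hh => S.α_of_mem (S.comm_le_expKer (S.iterate_lift_derived_le n hh))) ih

/-- Since `g` moves `x`, the inner commutator has section `h` at `x`; its other nontrivial section
is erased by the commutator with `single x k`. -/
theorem comm_comm_single_of_act_ne {g h k : G} (hh : S.α h = 0) (hk : S.α k = 0) {x : Fin p}
    (hx : S.act g x ≠ x) : ⁅⁅g, S.single x h⁻¹⁆, S.single x k⁆ = S.single x ⁅h, k⁆ := by
  have hh' : S.α h⁻¹ = 0 := by simpa
  have h1 : ∀ y, S.act ⁅g, S.single x h⁻¹⁆ y = y := fun y => by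
    rw [commutatorElement_def, S.act_mul, S.act_inv_of_act (S.act_single hh' x),
      S.act_conj g (S.act_single hh' x)]
  have h2 : S.sec ⁅g, S.single x h⁻¹⁆ x = h := by
    rw [commutatorElement_def, S.sec_mul_of_act _ (S.act_inv_of_act (S.act_single hh' x)),
      S.single_conj hh', S.sec_single (by simp [hh]), S.sec_inv_of_act (S.act_single hh' x),
      S.sec_single hh']
    simp [hx.symm]
  refine S.eq_single (S.act_comm h1 (S.act_single hk x)) (funext fun y => ?_)
    (by simp [commutatorElement_def])
  rw [S.sec_comm h1 (S.act_single hk x), S.sec_single hk]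
  by_cases hy : y = x
  · subst hy
    simp [h2]
  · simp [hy]

theorem comm_comm_single_of_act_eq {g h k : G} (hh : S.α h = 0) (hk : S.α k = 0) (x : Fin p)
    (hg : ∀ y, S.act g y = y) :
    ⁅⁅g, S.single x h⁆, S.single x k⁆ = S.single x ⁅⁅S.sec g x, h⁆, k⁆ := by
  have h1 := S.act_comm hg (S.act_single hh x)
  refine S.eq_single (S.act_comm h1 (S.act_single hk x)) (funext fun y => ?_)
    (by simp [commutatorElement_def])
  rw [S.sec_comm h1 (S.act_single hk x), S.sec_single hk, S.sec_comm hg (S.act_single hh x),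
    S.sec_single hh]
  by_cases hy : y = x
  · subst hy
    simp
  · simp [hy]

/-- Induction on the level at which `g` acts nontrivially. If `g` moves a letter, its double
commutators yield `single x ⁅h, k⁆`; otherwise pass to a section of `g` and to `comapSingle N x`,
which is why `N` is quantified inside. -/
theorem iterate_lift_derived_le_of_comm (n : ℕ) : ∀ g, g ∉ S.lift^[n] ⊤ →
    ∀ N : Subgroup G, N.Normal → (∀ h ∈ S.expKer, ∀ k ∈ S.expKer, ⁅⁅g, h⁆, k⁆ ∈ N) →
      S.lift^[n] ⁅S.expKer, S.expKer⁆ ≤ N := by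
  induction n with
  | zero => exact fun g hg => absurd trivial hg
  | succ n ih =>
    intro g hg N hN h
    rw [Function.iterate_succ_apply', mem_lift] at hg
    rw [Function.iterate_succ_apply']
    have := S.iterate_lift_normal ⁅S.expKer, S.expKer⁆ n
    by_cases hact : ∀ x, S.act g x = x
    · push Not at hg
      obtain ⟨x, hx⟩ := hg hact
      refine S.lift_le_of_le_comapSingle (ih _ hx (S.comapSingle N x) inferInstance ?_)
      intro h' hh' k hk
      refine ⟨?_, ?_⟩
      · have hL : S.expKer.Normal := inferInstance
        have : ⁅⁅S.sec g x, h'⁆, k⁆ = (⁅S.sec g x, h'⁆ * k * ⁅S.sec g x, h'⁆⁻¹) * k⁻¹ := rfl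
        rw [this]
        exact S.expKer.mul_mem (hL.conj_mem _ hk _) (S.expKer.inv_mem hk)
      · rw [← S.comm_comm_single_of_act_eq (S.α_of_mem hh') (S.α_of_mem hk) x hact]
        exact h _ (S.single_mem_expKer hh' x) _ (S.single_mem_expKer hk x)
    · push Not at hact
      obtain ⟨x, hx⟩ := hact
      refine (S.lift_mono (S.iterate_lift_derived_le n)).trans
        (S.lift_le_of_le_comapSingle (x := x) (Subgroup.commutator_le.mpr fun h' hh' k hk => ?_))
      refine ⟨S.comm_le_expKer (Subgroup.commutator_mem_commutator hh' hk), ?_⟩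
      rw [← S.comm_comm_single_of_act_ne (S.α_of_mem hh') (S.α_of_mem hk) hx]
      exact h _ (S.single_mem_expKer (S.expKer.inv_mem hh') x) _ (S.single_mem_expKer hk x)

/-- A nontrivial normal subgroup contains a large subgroup
of the form `lift^[n] ⁅expKer, expKer⁆`. -/
theorem exists_iterate_lift_derived_le {N : Subgroup G} [hN : N.Normal] (h : N ≠ ⊥) :
    ∃ n, S.lift^[n] ⁅S.expKer, S.expKer⁆ ≤ N := by
  obtain ⟨g, hg⟩ := Subgroup.ne_bot_iff_exists_ne_one.mp h
  have : ∃ n, (g : G) ∉ S.lift^[n] ⊤ := by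
    by_contra! hcon
    refine hg (Subtype.ext (S.faithful (fun g => ∀ n, g ∈ S.lift^[n] ⊤) ?_ g hcon))
    intro k hk x
    refine ⟨(hk 1).1 x, fun n => ?_⟩
    have := hk (n + 1)
    rw [Function.iterate_succ_apply'] at this
    exact this.2 x
  obtain ⟨n, hn⟩ := this
  have hc : ∀ k ∈ N, ∀ x, ⁅k, x⁆ ∈ N := fun k hk x => by
    rw [show ⁅k, x⁆ = k * (x * k⁻¹ * x⁻¹) by rw [commutatorElement_def]; group]
    exact N.mul_mem hk (hN.conj_mem _ (N.inv_mem hk) _)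
  exact ⟨n, S.iterate_lift_derived_le_of_comm n g hn N hN fun x _ y _ => hc _ (hc _ g.2 x) y⟩

/-- `single x` embeds each iterated lift into the next one, so commutativity moves up the levels. -/
theorem commutator_eq_bot_of_iterate_lift (n : ℕ)
    (h : ⁅S.lift^[n] ⁅S.expKer, S.expKer⁆, S.lift^[n] ⁅S.expKer, S.expKer⁆⁆ = ⊥) :
    ⁅⁅S.expKer, S.expKer⁆, ⁅S.expKer, S.expKer⁆⁆ = ⊥ := by
  induction n with
  | zero => exact h
  | succ n ih =>
    refine ih ?_
    rw [eq_bot_iff, Subgroup.commutator_le]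
    intro g hg k hk
    let x : Fin p := ⟨0, (Fact.out : p.Prime).pos⟩
    have hα : ∀ g ∈ S.lift^[n] ⁅S.expKer, S.expKer⁆, S.α g = 0 := fun g hg =>
      S.α_of_mem (S.comm_le_expKer (S.iterate_lift_derived_le n hg))
    have hs : ∀ g ∈ S.lift^[n] ⁅S.expKer, S.expKer⁆,
        S.single x g ∈ S.lift^[n + 1] ⁅S.expKer, S.expKer⁆ := by
      intro g hg
      rw [Function.iterate_succ_apply']
      refine ⟨S.act_single (hα g hg) x, fun y => ?_⟩
      rw [S.sec_single (hα g hg)]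
      by_cases hy : y = x
      · subst hy; simpa
      · simp [hy]
    have h1 := Subgroup.commutator_mem_commutator (hs g hg) (hs k hk)
    rw [h, ← S.single_comm (hα g hg) (hα k hk)] at h1
    exact S.single_injective (by simp [commutatorElement_def]) h1

/-- Both subgroups contain a common iterated lift, and that is not abelian. -/
theorem commutator_ne_bot (S : BasilicaGroup p G) {N₁ N₂ : Subgroup G} [N₁.Normal] [N₂.Normal]
    (h₁ : N₁ ≠ ⊥)
    (h₂ : N₂ ≠ ⊥) : ⁅N₁, N₂⁆ ≠ ⊥ := by
  obtain ⟨m, hm⟩ := S.exists_iterate_lift_derived_le h₁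
  obtain ⟨n, hn⟩ := S.exists_iterate_lift_derived_le h₂
  intro h
  refine S.derived_derived_expKer_ne_bot (S.commutator_eq_bot_of_iterate_lift (max m n) ?_)
  rw [← le_bot_iff, ← h]
  exact Subgroup.commutator_mono ((S.iterate_lift_derived_antitone (le_max_left m n)).trans hm)
    ((S.iterate_lift_derived_antitone (le_max_right m n)).trans hn)

end BasilicaGroup

-- Core-free maximal subgroups and their sections

namespace BasilicaGroup
variable {p : ℕ} {G : Type} [Group G] (S : BasilicaGroup p G)

theorem isCoatomic_subgroup (S : BasilicaGroup p G) : IsCoatomic (Subgroup G) := by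
  refine CompleteLattice.coatomic_of_top_compact
    ((CompleteLattice.isCompactElement_iff_le_of_directed_sSup_le _ _).mpr fun s hs hd h => ?_)
  have hmem : ∀ g, ∃ K ∈ s, g ∈ K := fun g =>
    (Subgroup.mem_sSup_of_directedOn hs hd).mp (h (Subgroup.mem_top g))
  obtain ⟨K₁, h1, ha⟩ := hmem S.a
  obtain ⟨K₂, h2, hb⟩ := hmem S.b
  obtain ⟨K, hK, h3, h4⟩ := hd K₁ h1 K₂ h2
  refine ⟨K, hK, ?_⟩
  rw [← S.closure_eq, Subgroup.closure_le]
  rintro g (rfl | rfl)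
  · exact h3 ha
  · exact h4 hb

end BasilicaGroup

/-- A maximal subgroup which contains no nontrivial normal subgroup. -/
structure CoreFreeMaximal {G : Type} [Group G] (M : Subgroup G) : Prop where
  isCoatom : IsCoatom M
  sup_eq_top : ∀ N : Subgroup G, N.Normal → N ≠ ⊥ → M ⊔ N = ⊤

theorem CoreFreeMaximal.exists_mul_eq {G : Type} [Group G] {M : Subgroup G}
    (hM : CoreFreeMaximal M) {N : Subgroup G} [hN : N.Normal] (h : N ≠ ⊥) (g : G) :
    ∃ m ∈ M, ∃ k ∈ N, m * k = g :=
  Subgroup.mem_sup_of_normal_right.mp (hM.sup_eq_top N hN h ▸ Subgroup.mem_top g)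

theorem CoreFreeMaximal.conj {G : Type} [Group G] {M : Subgroup G} (hM : CoreFreeMaximal M)
    (g : G) : CoreFreeMaximal (M.map (MulAut.conj g).toMonoidHom) := by
  let e : Subgroup G ≃o Subgroup G := (MulAut.conj g).mapSubgroup
  have he : ∀ K, e K = K.map (MulAut.conj g).toMonoidHom := fun _ => rfl
  refine ⟨(OrderIso.isCoatom_iff e M).mpr hM.isCoatom, fun N hN h => ?_⟩
  have h1 : e N = N := by
    ext x
    constructor
    · rintro ⟨y, hy, rfl⟩
      exact hN.conj_mem _ hy g
    · intro hx
      exact ⟨g⁻¹ * x * g, by simpa using hN.conj_mem _ hx g⁻¹, by simp [mul_assoc]⟩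
  rw [← he, ← h1, ← map_sup, hM.sup_eq_top N hN h, map_top]

namespace BasilicaGroup
variable {p : ℕ} {G : Type} [Group G] (S : BasilicaGroup p G) [Fact p.Prime]

theorem finiteIndex_or_coreFreeMaximal (S : BasilicaGroup p G) {M : Subgroup G} (hM : IsCoatom M) :
    M.FiniteIndex ∨ CoreFreeMaximal M := by
  by_cases h : ∀ N : Subgroup G, N.Normal → N ≠ ⊥ → M ⊔ N = ⊤
  · exact Or.inr ⟨hM, h⟩
  · push Not at h
    obtain ⟨N, hN, hN1, hN2⟩ := h
    obtain ⟨n, hn⟩ := S.exists_iterate_lift_derived_le hN1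
    have hNM : N ≤ M := by
      by_contra hcon
      exact hN2 (hM.2 _ (left_lt_sup.mpr hcon))
    exact Or.inl (S.finiteIndex_of_iterate_lift_le hM (hn.trans hNM))

theorem expKer_ne_bot : S.expKer ≠ ⊥ := fun h =>
  S.derived_expKer_ne_bot (by rw [h, Subgroup.commutator_bot_left])

theorem inf_expKer_ne_bot {N : Subgroup G} [N.Normal] (h : N ≠ ⊥) : N ⊓ S.expKer ≠ ⊥ := by
  obtain ⟨n, hn⟩ := S.exists_iterate_lift_derived_le h
  intro h0
  refine S.iterate_lift_derived_ne_bot n (le_bot_iff.mp (h0 ▸ le_inf hn ?_))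
  exact (S.iterate_lift_derived_le n).trans S.comm_le_expKer

/-- `M` supplements `lift (N ⊓ expKer)`; the intersection with `expKer` makes the lift nontrivial.
-/
theorem secImage_sup {M : Subgroup G} (hM : CoreFreeMaximal M) (x : Fin p) {N : Subgroup G}
    [N.Normal] (h : N ≠ ⊥) : S.secImage M x ⊔ N = ⊤ := by
  rw [eq_top_iff]
  intro g _
  obtain ⟨g', h1, rfl⟩ := S.exists_sec_eq g x
  have hK : S.lift (N ⊓ S.expKer) ≠ ⊥ :=
    S.lift_ne_bot (fun h hh => S.α_of_mem hh.2) (S.inf_expKer_ne_bot h)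
  obtain ⟨m, hm, k, hk, hmk⟩ := hM.exists_mul_eq hK g'
  have hact : ∀ y, S.act m y = y := fun y => by
    rw [← hk.1 y, ← S.act_mul, hmk, h1, hk.1]
  refine Subgroup.mem_sup_of_normal_right.mpr
    ⟨S.sec m x, S.mem_secImage.mpr ⟨m, hm, hact, rfl⟩, S.sec k x, (hk.2 x).1, ?_⟩
  rw [← S.sec_mul_of_act _ hk.1, hmk]

theorem act_eq_act {g h : G} (hgh : (p : ℤ) ∣ S.β g - S.β h) (x : Fin p) :
    S.act g x = S.act h x := by
  have : S.act (h⁻¹ * g) x = x := by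
    rw [S.act_eq_self_iff, S.β_mul, S.β_inv, neg_add_eq_sub]
    exact hgh
  rw [S.act_mul] at this
  conv_rhs => rw [← this]
  rw [S.act_act_inv]

theorem exists_mem_act_eq {M : Subgroup G} (hM : CoreFreeMaximal M) (x y : Fin p) :
    ∃ m ∈ M, S.act m x = y := by
  obtain ⟨m, hm, k, hk, hmk⟩ := hM.exists_mul_eq S.expKer_ne_bot S.b
  have hβ : S.β m = 1 := by
    have := congrArg S.β hmk
    rwa [S.β_mul, (S.mem_expKer.mp hk).2, add_zero, S.β_b] at this
  obtain ⟨g, rfl⟩ := S.exists_act_eq x y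
  exact ⟨m ^ S.β g, M.zpow_mem hm _, S.act_eq_act (by simp [hβ]) x⟩

/-- The elements of `M` that fix the letters and have trivial sections outside of `T`. -/
def supported (M : Subgroup G) (T : Finset (Fin p)) : Subgroup G where
  carrier := {m | m ∈ M ∧ (∀ x, S.act m x = x) ∧ ∀ x ∉ T, S.sec m x = 1}
  one_mem' := ⟨M.one_mem, by simp, by simp⟩
  mul_mem' := by
    rintro g h ⟨g1, g2, g3⟩ ⟨h1, h2, h3⟩
    exact ⟨M.mul_mem g1 h1, fun x => by simp [g2, h2], fun x hx => by simp [h2, g3 x hx, h3 x hx]⟩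
  inv_mem' := by
    rintro g ⟨g1, g2, g3⟩
    exact ⟨M.inv_mem g1, S.act_inv_of_act g2, fun x hx => by simp [S.sec_inv_of_act g2, g3 x hx]⟩

theorem secImage_supported_normal {M : Subgroup G} {x : Fin p} (h : S.secImage M x = ⊤)
    (T : Finset (Fin p)) : (S.secImage (S.supported M T) x).Normal := by
  refine ⟨fun k hk g => ?_⟩
  obtain ⟨m, hm, h1, rfl⟩ := S.mem_secImage.mp hk
  obtain ⟨n, hn, h2, rfl⟩ := S.mem_secImage.mp (h ▸ Subgroup.mem_top g)
  have h3 := S.sec_conj n h1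
  simp only [h2] at h3
  exact S.mem_secImage.mpr ⟨n * m * n⁻¹, ⟨M.mul_mem (M.mul_mem hn hm.1) (M.inv_mem hn),
    S.act_conj n h1, fun y hy => by rw [h3, hm.2.2 y hy, mul_one, mul_inv_cancel]⟩,
    S.act_conj n h1, h3 x⟩

theorem secImage_eq_top_of_eq_top {M : Subgroup G} (hM : CoreFreeMaximal M) {x : Fin p}
    (h : S.secImage M x = ⊤) (y : Fin p) : S.secImage M y = ⊤ := by
  rw [eq_top_iff]
  intro g _
  obtain ⟨m, hm, rfl⟩ := S.exists_mem_act_eq hM x y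
  obtain ⟨k, hk, h1, h2⟩ := S.mem_secImage.mp
    (h ▸ Subgroup.mem_top ((S.sec m x)⁻¹ * g * S.sec m x))
  refine S.mem_secImage.mpr ⟨m * k * m⁻¹, M.mul_mem (M.mul_mem hm hk) (M.inv_mem hm),
    S.act_conj m h1, ?_⟩
  rw [S.sec_conj m h1, h2]
  group

theorem secImage_supported_ne_bot {M : Subgroup G} {T : Finset (Fin p)} {x : Fin p}
    (h1 : S.supported M T ≠ ⊥) (h2 : S.supported M (T.erase x) = ⊥) :
    S.secImage (S.supported M T) x ≠ ⊥ := by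
  intro h
  refine h1 (le_bot_iff.mp (h2 ▸ fun m hm => ⟨hm.1, hm.2.1, fun y hy => ?_⟩))
  by_cases hyx : y = x
  · subst hyx
    have : S.sec m y ∈ S.secImage (S.supported M T) y := S.mem_secImage.mpr ⟨m, hm, hm.2.1, rfl⟩
    rw [h] at this
    exact this
  · exact hm.2.2 y fun hyT => hy (Finset.mem_erase.mpr ⟨hyx, hyT⟩)

/-- Commutators of elements with supports `T₁` and `T₂` live on `T₁ ∩ T₂`. At `x` they fill the
commutator of two nontrivial normal subgroups of `G`. -/
theorem supported_inter_ne_bot {M : Subgroup G} {T₁ T₂ : Finset (Fin p)} {x : Fin p}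
    (h : S.secImage M x = ⊤) (h₁ : S.secImage (S.supported M T₁) x ≠ ⊥)
    (h₂ : S.secImage (S.supported M T₂) x ≠ ⊥) : S.supported M (T₁ ∩ T₂) ≠ ⊥ := by
  have := S.secImage_supported_normal h T₁
  have := S.secImage_supported_normal h T₂
  intro h0
  refine S.commutator_ne_bot h₁ h₂ (le_bot_iff.mp (Subgroup.commutator_le.mpr fun g hg k hk => ?_))
  obtain ⟨m, hm, m1, rfl⟩ := S.mem_secImage.mp hg
  obtain ⟨n, hn, n1, rfl⟩ := S.mem_secImage.mp hk
  have hmn : ⁅m, n⁆ ∈ S.supported M (T₁ ∩ T₂) := by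
    refine ⟨M.mul_mem (M.mul_mem (M.mul_mem hm.1 hn.1) (M.inv_mem hm.1)) (M.inv_mem hn.1),
      S.act_comm m1 n1, fun y hy => ?_⟩
    rw [S.sec_comm m1 n1]
    by_cases hy1 : y ∈ T₁
    · rw [hn.2.2 y fun hy2 => hy (Finset.mem_inter.mpr ⟨hy1, hy2⟩), commutatorElement_one_right]
    · rw [hm.2.2 y hy1, commutatorElement_one_left]
  rw [h0, Subgroup.mem_bot] at hmn
  rw [Subgroup.mem_bot, ← S.sec_comm m1 n1, hmn, S.sec_one]

theorem supported_image_ne_bot {M : Subgroup G} {T : Finset (Fin p)} {m : G} (hm : m ∈ M)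
    (h : S.supported M T ≠ ⊥) : S.supported M (T.image (S.act m)) ≠ ⊥ := by
  obtain ⟨k, hk, hk1⟩ := (Subgroup.bot_or_exists_ne_one _).resolve_left h
  intro h0
  have : m * k * m⁻¹ ∈ S.supported M (T.image (S.act m)) := by
    refine ⟨M.mul_mem (M.mul_mem hm hk.1) (M.inv_mem hm), S.act_conj m hk.2.1, fun y hy => ?_⟩
    obtain ⟨z, rfl⟩ := (S.actEquiv m).surjective y
    rw [S.actEquiv_apply] at hy ⊢
    rw [S.sec_conj m hk.2.1, hk.2.2 z fun hz => hy (Finset.mem_image_of_mem _ hz), mul_one,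
      mul_inv_cancel]
  rw [h0, Subgroup.mem_bot] at this
  exact hk1 (by simpa using this)

theorem eq_univ_of_image_eq {T : Finset (Fin p)} {m : G} {x : Fin p} (hx : x ∈ T)
    (hm : S.act m x ≠ x) (h : T.image (S.act m) = T) : T = Finset.univ := by
  have hpow : ∀ j : ℕ, S.act (m ^ j) x ∈ T := by
    intro j
    induction j with
    | zero => simpa
    | succ j ih =>
      rw [pow_succ', S.act_mul, ← h]
      exact Finset.mem_image_of_mem _ ih
  have hβ : ((S.β m : ℤ) : ZMod p) ≠ 0 := by
    rwa [Ne, ZMod.intCast_zmod_eq_zero_iff_dvd, ← S.act_eq_self_iff m x]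
  rw [Finset.eq_univ_iff_forall]
  intro y
  obtain ⟨g, rfl⟩ := S.exists_act_eq x y
  -- The exponent solves `j * β m ≡ β g` mod `p`.
  convert hpow (((S.β g : ℤ) : ZMod p) / (S.β m : ℤ)).val using 1
  refine S.act_eq_act ?_ x
  rw [← ZMod.intCast_zmod_eq_zero_iff_dvd, S.β_pow]
  push_cast
  rw [ZMod.natCast_val, ZMod.cast_id, div_mul_cancel₀ _ hβ, sub_self]

/-- Otherwise the section at `x` determines an element of the letter stabilizer of `M`, and `β` of
the section at `y` becomes a linear function of the exponents at `x`. But `M` contains an element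
with exponents zero at `x` and `β = 1` at `y`, namely one congruent to `single y b` modulo `lift
expKer`. -/
theorem exists_supported_proper_ne_bot {M : Subgroup G} (hM : CoreFreeMaximal M) {x y : Fin p}
    (hxy : x ≠ y) (h : S.secImage M x = ⊤) : S.supported M (Finset.univ.erase x) ≠ ⊥ := by
  intro h0
  have hinj : ∀ m ∈ M, (∀ z, S.act m z = z) → S.sec m x = 1 → m = 1 := by
    intro m hm h1 h2
    have : m ∈ S.supported M (Finset.univ.erase x) :=
      ⟨hm, h1, fun z hz => by
        obtain rfl : z = x := by simpa using hz
        exact h2⟩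
    rwa [h0] at this
  obtain ⟨u, hu, hu1, hu2⟩ := S.mem_secImage.mp (h ▸ Subgroup.mem_top S.a)
  obtain ⟨v, hv, hv1, hv2⟩ := S.mem_secImage.mp (h ▸ Subgroup.mem_top S.b)
  have key : ∀ g, ∃ m ∈ M, (∀ z, S.act m z = z) ∧ S.sec m x = g ∧
      S.β (S.sec m y) = S.α g * S.β (S.sec u y) + S.β g * S.β (S.sec v y) := by
    intro g
    refine S.induction_gen (P := fun g => ∃ m ∈ M, (∀ z, S.act m z = z) ∧ S.sec m x = g ∧
      S.β (S.sec m y) = S.α g * S.β (S.sec u y) + S.β g * S.β (S.sec v y))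
      ⟨u, hu, hu1, hu2, by simp⟩ ⟨v, hv, hv1, hv2, by simp⟩ ⟨1, M.one_mem, by simp⟩ ?_ ?_ g
    · rintro _ _ ⟨m, hm, m1, rfl, m2⟩ ⟨n, hn, n1, rfl, n2⟩
      refine ⟨m * n, M.mul_mem hm hn, fun z => by simp [m1, n1], S.sec_mul_of_act m n1 x, ?_⟩
      rw [S.sec_mul_of_act m n1, S.β_mul, m2, n2, S.α_mul, S.β_mul]
      ring
    · rintro _ ⟨m, hm, m1, rfl, m2⟩
      refine ⟨m⁻¹, M.inv_mem hm, S.act_inv_of_act m1, S.sec_inv_of_act m1 x, ?_⟩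
      rw [S.sec_inv_of_act m1, S.β_inv, m2, S.α_inv, S.β_inv]
      ring
  have hK : S.lift S.expKer ≠ ⊥ := S.lift_ne_bot (fun _ => S.α_of_mem) S.expKer_ne_bot
  obtain ⟨m, hm, k, hk, hmk⟩ := hM.exists_mul_eq hK (S.single y S.b)
  have m1 : ∀ z, S.act m z = z := fun z => by
    rw [← hk.1 z, ← S.act_mul, hmk, S.act_single S.α_b, hk.1]
  have hsec : ∀ z, S.sec m z * S.sec k z = (Pi.mulSingle y S.b : Fin p → G) z := fun z => by
    rw [← S.sec_mul_of_act m hk.1, hmk, S.sec_single S.α_b]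
  have hα : S.α (S.sec m x) = 0 := by
    have := congrArg S.α (hsec x)
    rwa [S.α_mul, S.α_of_mem (hk.2 x), add_zero, Pi.mulSingle_eq_of_ne hxy, S.α_one] at this
  have hβ : S.β (S.sec m x) = 0 := by
    have := congrArg S.β (hsec x)
    rwa [S.β_mul, (S.mem_expKer.mp (hk.2 x)).2, add_zero, Pi.mulSingle_eq_of_ne hxy,
      S.β_one] at this
  have hβ' : S.β (S.sec m y) = 1 := by
    have := congrArg S.β (hsec y)
    rwa [S.β_mul, (S.mem_expKer.mp (hk.2 y)).2, add_zero, Pi.mulSingle_eq_same, S.β_b] at this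
  obtain ⟨n, hn, n1, n2, n3⟩ := key (S.sec m x)
  have hmn : n = m := by
    rw [← inv_mul_eq_one]
    refine hinj _ (M.mul_mem (M.inv_mem hn) hm) (fun z => ?_) ?_
    · rw [S.act_mul, m1, S.act_inv_of_act n1]
    · rw [S.sec_mul_of_act _ m1, S.sec_inv_of_act n1, n2, inv_mul_cancel]
  rw [hmn, hβ', hα, hβ] at n3
  simp at n3

/-- Otherwise the sections `R` at `x` form a nontrivial normal subgroup of `G`, and transitivity of
`M` on letters puts the normal subgroup `lift R` inside `M`. -/
theorem supported_singleton_eq_bot {M : Subgroup G} (hM : CoreFreeMaximal M) {x y : Fin p}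
    (hxy : x ≠ y) (h : S.secImage M x = ⊤) : S.supported M {x} = ⊥ := by
  by_contra h0
  have hR := S.secImage_supported_normal h {x}
  set R := S.secImage (S.supported M {x}) x with hRdef
  have hmem : ∀ k ∈ R, S.α k = 0 ∧ S.single x k ∈ M := by
    intro k hk
    obtain ⟨m, hm, h1, rfl⟩ := S.mem_secImage.mp hk
    have hα : S.α (S.sec m x) = 0 := by
      have h2 := S.α_sec_of_act (h1 x)
      rw [← S.α_sec_of_act (h1 y), hm.2.2 y (by simpa using hxy.symm), S.α_one, mul_zero] at h2
      exact (mul_eq_zero.mp h2).resolve_left (by exact_mod_cast (Fact.out : p.Prime).ne_zero)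
    refine ⟨hα, ?_⟩
    rw [← S.eq_single h1 (funext fun z => ?_) hα]
    · exact hm.1
    · by_cases hz : z = x
      · subst hz; simp
      · rw [hm.2.2 z (by simpa using hz), Pi.mulSingle_eq_of_ne hz]
  have hle : S.lift R ≤ M := by
    refine S.lift_le_of_single (fun k hk => (hmem k hk).1) fun z k hk => ?_
    obtain ⟨m, hm, rfl⟩ := S.exists_mem_act_eq hM x z
    have hk' := hR.conj_mem _ hk (S.sec m x)⁻¹
    have := S.single_conj (hmem _ hk').1 m x
    rw [show S.sec m x * ((S.sec m x)⁻¹ * k * (S.sec m x)⁻¹⁻¹) * (S.sec m x)⁻¹ = k by group]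
      at this
    rw [← this]
    exact M.mul_mem (M.mul_mem hm (hmem _ hk').2) (M.inv_mem hm)
  have hRb : R ≠ ⊥ := S.secImage_supported_ne_bot h0 (by
    rw [Finset.erase_singleton, eq_bot_iff]
    exact fun m hm => S.eq_one_of_sec hm.2.1 fun z => hm.2.2 z (by simp))
  have := hM.sup_eq_top _ (S.lift_normal R) (S.lift_ne_bot (fun k hk => (hmem k hk).1) hRb)
  rw [sup_eq_left.mpr hle] at this
  exact hM.isCoatom.1 this

/-- If the sections were all of `G`, two minimal supports of elements of `M` that meet would
coincide, so minimal supports would be blocks for a transitive action of prime degree: singletons or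
the whole alphabet. The two preceding lemmas exclude both. -/
theorem secImage_ne_top {M : Subgroup G} (hM : CoreFreeMaximal M) (x : Fin p) :
    S.secImage M x ≠ ⊤ := by
  intro hx
  have htop := S.secImage_eq_top_of_eq_top hM hx
  have : Nontrivial (Fin p) := Fin.nontrivial_iff_two_le.mpr (Fact.out : p.Prime).two_le
  obtain ⟨y, hy⟩ := exists_ne x
  obtain ⟨T, hT, hmin⟩ := (measure (Finset.card (α := Fin p))).wf.has_min
    {T | S.supported M T ≠ ⊥} ⟨_, S.exists_supported_proper_ne_bot hM hy.symm hx⟩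
  have hmin' : ∀ U : Finset (Fin p), U.card < T.card → S.supported M U = ⊥ := fun U hU => by
    by_contra h
    exact hmin U h hU
  have hTu : T ≠ Finset.univ := by
    rintro rfl
    exact S.exists_supported_proper_ne_bot hM hy.symm hx
      (hmin' _ (Finset.card_erase_lt_of_mem (Finset.mem_univ x)))
  have heq : ∀ U : Finset (Fin p), S.supported M U ≠ ⊥ → U.card = T.card → ∀ z ∈ T, z ∈ U →
      U = T := by
    intro U hU hc z hz hzU
    have h1 := S.secImage_supported_ne_bot hT (hmin' _ (Finset.card_erase_lt_of_mem hz))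
    have h2 := S.secImage_supported_ne_bot hU
      (hmin' _ ((Finset.card_erase_lt_of_mem hzU).trans_eq hc))
    have h3 := S.supported_inter_ne_bot (htop z) h2 h1
    have h4 : T.card ≤ (U ∩ T).card := by
      by_contra hlt
      exact h3 (hmin' _ (not_le.mp hlt))
    have h5 : U ∩ T = T := Finset.eq_of_subset_of_card_le Finset.inter_subset_right h4
    exact (Finset.eq_of_subset_of_card_le (Finset.inter_eq_right.mp h5) hc.le).symm
  have hne : T.Nonempty := by
    by_contra h
    rw [Finset.not_nonempty_iff_eq_empty] at h
    subst h
    exact hT (eq_bot_iff.mpr fun m hm => S.eq_one_of_sec hm.2.1 fun z => hm.2.2 z (by simp))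
  obtain ⟨z, hz⟩ := hne
  by_cases hw : ∃ w ∈ T, w ≠ z
  · obtain ⟨w, hwT, hwz⟩ := hw
    obtain ⟨m, hm, rfl⟩ := S.exists_mem_act_eq hM z w
    refine hTu (S.eq_univ_of_image_eq hz hwz (heq _ (S.supported_image_ne_bot hm hT) ?_ _ hwT
      (Finset.mem_image_of_mem _ hz)))
    exact Finset.card_image_of_injective _ (S.actEquiv m).injective
  · push Not at hw
    have : T = {z} := Finset.eq_singleton_iff_unique_mem.mpr ⟨hz, hw⟩
    subst this
    obtain ⟨y, hy⟩ := exists_ne z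
    exact hT (S.supported_singleton_eq_bot hM hy.symm (htop z))

/-- The sections of the elements of a core-free maximal subgroup lie in
a core-free maximal subgroup. -/
theorem exists_coreFreeMaximal_sec_mem {M : Subgroup G} (hM : CoreFreeMaximal M) (x : Fin p) :
    ∃ M' : Subgroup G, CoreFreeMaximal M' ∧
      ∀ m ∈ M, (∀ y, S.act m y = y) → S.sec m x ∈ M' := by
  have := S.isCoatomic_subgroup
  obtain ⟨M', h1, h2⟩ := (eq_top_or_exists_le_coatom (S.secImage M x)).resolve_left
    (S.secImage_ne_top hM x)
  refine ⟨M', ⟨h1, fun N hN h => ?_⟩, fun m hm hact => h2 (S.mem_secImage.mpr ⟨m, hm, hact, rfl⟩)⟩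
  rw [eq_top_iff, ← S.secImage_sup hM x h]
  exact sup_le_sup_right h2 _

end BasilicaGroup

-- Word length and the descent to `b a⁻¹`

/-- `CostLE Z A g n` says that `g` is a product of elements of `Z` and of at most `n` elements
of `A`. -/
inductive CostLE {G : Type} [Group G] (Z : Subgroup G) (A : Set G) : G → ℕ → Prop
  | free {z : G} (n : ℕ) (hz : z ∈ Z) : CostLE Z A z n
  | cons {z y g : G} {n : ℕ} (hz : z ∈ Z) (hy : y ∈ A) (hg : CostLE Z A g n) :
      CostLE Z A (z * y * g) (n + 1)

namespace CostLE
variable {G : Type} [Group G] {Z : Subgroup G} {A : Set G} {g h z y : G} {m n : ℕ}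

theorem mono (hg : CostLE Z A g n) (h : n ≤ m) : CostLE Z A g m := by
  induction hg generalizing m with
  | free n hz => exact free m hz
  | cons hz hy _ ih =>
    obtain ⟨m, rfl⟩ := Nat.exists_eq_add_of_le' (show 1 ≤ m by omega)
    exact cons hz hy (ih (by omega))

theorem free_mul (hz : z ∈ Z) (hg : CostLE Z A g n) : CostLE Z A (z * g) n := by
  cases hg with
  | free n hz' => exact free n (Z.mul_mem hz hz')
  | cons hz' hy hg =>
    rw [← mul_assoc, ← mul_assoc]
    exact cons (Z.mul_mem hz hz') hy hg

theorem mul (hg : CostLE Z A g m) (hh : CostLE Z A h n) : CostLE Z A (g * h) (m + n) := by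
  induction hg with
  | free m hz => exact (hh.free_mul hz).mono (by omega)
  | cons hz hy _ ih =>
    rw [mul_assoc]
    exact (cons hz hy ih).mono (by omega)

theorem of_mem (hy : y ∈ A) : CostLE Z A y 1 := by
  simpa using cons Z.one_mem hy (free 0 Z.one_mem)

theorem inv (hA : ∀ y ∈ A, y⁻¹ ∈ A) (hg : CostLE Z A g n) : CostLE Z A g⁻¹ n := by
  induction hg with
  | free n hz => exact free n (Z.inv_mem hz)
  | cons hz hy _ ih =>
    rw [mul_inv_rev, mul_inv_rev]
    exact ih.mul ((of_mem (hA _ hy)).mul (free 0 (Z.inv_mem hz)))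

theorem exists_list (hg : CostLE ⊥ A g n) :
    ∃ l : List G, l.prod = g ∧ l.length ≤ n ∧ ∀ y ∈ l, y ∈ A := by
  induction hg with
  | free n hz => exact ⟨[], by simpa using (Subgroup.mem_bot.mp hz).symm, by simp, by simp⟩
  | @cons z y g n hz hy _ ih =>
    obtain ⟨l, rfl, h1, h2⟩ := ih
    exact ⟨y :: l, by simp [Subgroup.mem_bot.mp hz], by simpa, by simpa [hy] using h2⟩

end CostLE

namespace BasilicaGroup
variable {p : ℕ} {G : Type} [Group G] (S : BasilicaGroup p G)

/-- The total cost of the sections of `g` is at most `n`. -/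
def SecCostLE (Z : Subgroup G) (A : Set G) (g : G) (n : ℕ) : Prop :=
  ∃ f : Fin p → ℕ, ∑ x, f x ≤ n ∧ ∀ x, CostLE Z A (S.sec g x) (f x)

variable {S}

theorem SecCostLE.free {Z : Subgroup G} {A : Set G} {g : G} (hg : ∀ x, S.sec g x ∈ Z) (n : ℕ) :
    S.SecCostLE Z A g n :=
  ⟨0, by simp, fun x => CostLE.free _ (hg x)⟩

theorem SecCostLE.mul {Z : Subgroup G} {A : Set G} {g h : G} {m n : ℕ}
    (hg : S.SecCostLE Z A g m) (hh : S.SecCostLE Z A h n) : S.SecCostLE Z A (g * h) (m + n) := by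
  obtain ⟨f, f1, f2⟩ := hg
  obtain ⟨k, k1, k2⟩ := hh
  refine ⟨fun x => f (S.act h x) + k x, ?_, fun x => ?_⟩
  · rw [Finset.sum_add_distrib]
    exact add_le_add ((Equiv.sum_comp (S.actEquiv h) f).trans_le f1) k1
  · rw [S.sec_mul]
    exact (f2 _).mul (k2 x)

theorem SecCostLE.mono {Z : Subgroup G} {A : Set G} {g : G} {m n : ℕ}
    (hg : S.SecCostLE Z A g m) (h : m ≤ n) : S.SecCostLE Z A g n := by
  obtain ⟨f, f1, f2⟩ := hg
  exact ⟨f, f1.trans h, f2⟩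

theorem _root_.CostLE.secCostLE {Z : Subgroup G} {A : Set G} {g : G} {n : ℕ}
    (hZ : ∀ z ∈ Z, ∀ x, S.sec z x ∈ Z) (hA : ∀ y ∈ A, S.SecCostLE Z A y 1)
    (hg : CostLE Z A g n) : S.SecCostLE Z A g n := by
  induction hg with
  | free n hz => exact .free (hZ _ hz) n
  | cons hz hy _ ih => exact (((SecCostLE.free (hZ _ hz) 0).mul (hA _ hy)).mul ih).mono (by omega)

theorem SecCostLE.of_single {Z : Subgroup G} {A : Set G} {g : G} (y : Fin p)
    (h1 : CostLE Z A (S.sec g y) 1) (h2 : ∀ x, x ≠ y → S.sec g x ∈ Z) : S.SecCostLE Z A g 1 := by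
  refine ⟨Pi.single y 1, by simp, fun x => ?_⟩
  by_cases hx : x = y
  · subst hx
    simpa using h1
  · rw [Pi.single_eq_of_ne hx]
    exact .free 0 (h2 x hx)

variable (S)

theorem costLE_sec_pow {Z : Subgroup G} {A : Set G} {g : G} {f : Fin p → ℕ}
    (hf : ∀ x, CostLE Z A (S.sec g x) (f x)) (k : ℕ) (x : Fin p) :
    CostLE Z A (S.sec (g ^ k) x) (∑ j ∈ Finset.range k, f (S.act (g ^ j) x)) := by
  induction k with
  | zero => exact .free _ (by simp [Z.one_mem])
  | succ k ih =>
    rw [pow_succ', S.sec_mul, Finset.sum_range_succ, add_comm]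
    exact (hf _).mul ih

variable [Fact p.Prime]

theorem β_sec_pow (g : G) (k : ℕ) (x : Fin p) :
    S.β (S.sec (g ^ k) x) = ∑ j ∈ Finset.range k, S.β (S.sec g (S.act (g ^ j) x)) := by
  induction k with
  | zero => simp
  | succ k ih =>
    rw [pow_succ', S.sec_mul, S.β_mul, Finset.sum_range_succ, add_comm, ih]

/-- An element with `β = 1` permutes the letters in one `p`-cycle. -/
theorem sum_orbit {R : Type} [AddCommMonoid R] {g : G} (hg : S.β g = 1) (f : Fin p → R)
    (x : Fin p) : ∑ j ∈ Finset.range p, f (S.act (g ^ j) x) = ∑ y, f y := by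
  rw [Finset.sum_range fun j => f (S.act (g ^ j) x)]
  refine Function.Bijective.sum_comp (e := fun j : Fin p => S.act (g ^ (j : ℕ)) x)
    (Finite.injective_iff_bijective.mp fun i j hij => ?_) f
  have h1 : S.act ((g ^ (j : ℕ))⁻¹ * g ^ (i : ℕ)) x = x := by
    rw [S.act_mul, hij, S.act_inv_act]
  rw [S.act_eq_self_iff] at h1
  simp only [S.β_mul, S.β_inv, S.β_pow, hg] at h1
  have h2 : ((i : ℕ) : ℤ) - (j : ℕ) = 0 :=
    Int.eq_zero_of_abs_lt_dvd (m := p) (by convert h1 using 1; ring)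
      (abs_lt.mpr ⟨by omega, by omega⟩)
  exact Fin.ext (by omega)

/-- The letters of the words in the generators. -/
def letters : Set G := {S.a, S.a⁻¹, S.b, S.b⁻¹}

theorem inv_mem_letters : ∀ y ∈ S.letters, y⁻¹ ∈ S.letters := by
  rintro _ (rfl | rfl | rfl | rfl) <;> simp [letters]

theorem exists_last : ∃ l : Fin p, (l : ℕ) + 1 = p := by
  have hp : 0 < p := (Fact.out : p.Prime).pos
  exact ⟨⟨p - 1, by omega⟩, by simp only; omega⟩

theorem sec_mem_bot (z : G) (hz : z ∈ (⊥ : Subgroup G)) (x : Fin p) :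
    S.sec z x ∈ (⊥ : Subgroup G) := by
  rw [Subgroup.mem_bot.mp hz, S.sec_one]
  exact Subgroup.one_mem _

theorem secCostLE_letters : ∀ y ∈ S.letters, S.SecCostLE ⊥ S.letters y 1 := by
  obtain ⟨l, hl⟩ := exists_last (p := p)
  have hne : ∀ x, x ≠ l → (x : ℕ) + 1 ≠ p := fun x hx h => hx (Fin.ext (by omega))
  rintro _ (rfl | rfl | rfl | rfl)
  · refine .of_single l ?_ fun x hx => ?_
    · rw [S.sec_a, if_pos hl]
      exact .of_mem (by simp [letters])
    · rw [S.sec_a, if_neg (hne x hx)]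
      exact Subgroup.one_mem _
  · refine .of_single l ?_ fun x hx => ?_
    · rw [S.sec_inv_of_act S.act_a, S.sec_a, if_pos hl]
      exact .of_mem (by simp [letters])
    · rw [S.sec_inv_of_act S.act_a, S.sec_a, if_neg (hne x hx)]
      simp
  · refine .of_single l ?_ fun x hx => ?_
    · rw [S.sec_b, if_pos hl]
      exact .of_mem (by simp [letters])
    · rw [S.sec_b, if_neg (hne x hx)]
      exact Subgroup.one_mem _
  · refine .of_single (S.act S.b l) ?_ fun x hx => ?_
    · rw [S.sec_inv, S.act_inv_act, S.sec_b, if_pos hl]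
      exact .of_mem (by simp [letters])
    · rw [S.sec_inv, S.sec_b, if_neg (hne _ fun h => hx (by rw [← h, S.act_act_inv]))]
      simp

/-- `b⁻¹ a b` has a single nontrivial section `b`, at the last letter but one: the two letters `b⁻¹`
and `b` cost nothing, which is the gain that drives the first descent. -/
theorem secCostLE_conj_a :
    S.SecCostLE ⊥ S.letters (S.b⁻¹ * S.a * S.b) 1 ∧
      S.SecCostLE ⊥ S.letters (S.b⁻¹ * S.a⁻¹ * S.b) 1 := by
  have hp : 2 ≤ p := (Fact.out : p.Prime).two_le
  obtain ⟨l, hl⟩ := exists_last (p := p)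
  let m : Fin p := ⟨p - 2, by omega⟩
  have hm : S.act S.b m = l := Fin.ext (by
    rw [S.act_b]
    simp only [m]
    rw [if_neg (by omega)]
    omega)
  have hm' : ¬ (m : ℕ) + 1 = p := by simp only [m]; omega
  have hact : ∀ x, S.act (S.b⁻¹ * S.a * S.b) x = x := fun x => by simp
  have hsec : ∀ x, S.sec (S.b⁻¹ * S.a * S.b) x = if x = m then S.b else 1 := by
    intro x
    rw [S.sec_mul, S.sec_mul, S.act_a, S.sec_inv, S.act_inv_act, S.sec_a]
    by_cases hx : x = m
    · subst hx
      rw [hm, if_pos hl, if_pos rfl, S.sec_b, if_neg hm']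
      simp
    · have : ¬ (S.act S.b x : ℕ) + 1 = p := fun h =>
        hx ((S.actEquiv S.b).injective (Fin.ext (by simp only [S.actEquiv_apply, hm]; omega)))
      rw [if_neg this, if_neg hx]
      simp
  have hinv : S.b⁻¹ * S.a⁻¹ * S.b = (S.b⁻¹ * S.a * S.b)⁻¹ := by group
  refine ⟨.of_single m ?_ fun x hx => ?_, .of_single m ?_ fun x hx => ?_⟩
  · rw [hsec, if_pos rfl]
    exact .of_mem (by simp [letters])
  · rw [hsec, if_neg hx]
    exact Subgroup.one_mem _
  · rw [hinv, S.sec_inv_of_act hact, hsec, if_pos rfl]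
    exact .of_mem (by simp [letters])
  · rw [hinv, S.sec_inv_of_act hact, hsec, if_neg hx]
    simp

theorem costLE_prod {l : List G} (hl : ∀ y ∈ l, y ∈ S.letters) :
    CostLE ⊥ S.letters l.prod l.length := by
  induction l with
  | nil => exact .free _ (Subgroup.one_mem _)
  | cons y l ih =>
    rw [List.prod_cons, List.length_cons, add_comm]
    exact (CostLE.of_mem (hl y (by simp))).mul (ih fun z hz => hl z (by simp [hz]))

theorem secCostLE_prod {l : List G} (hl : ∀ y ∈ l, y ∈ S.letters) :
    S.SecCostLE ⊥ S.letters l.prod l.length :=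
  (S.costLE_prod hl).secCostLE S.sec_mem_bot S.secCostLE_letters

theorem secCostLE_conj_prod {l : List G} (hl : ∀ y ∈ l, y = S.a ∨ y = S.a⁻¹) :
    S.SecCostLE ⊥ S.letters (S.b⁻¹ * l.prod * S.b) l.length := by
  induction l with
  | nil => exact .free (by simp) _
  | cons y l ih =>
    rw [List.prod_cons, List.length_cons, add_comm,
      show S.b⁻¹ * (y * l.prod) * S.b = (S.b⁻¹ * y * S.b) * (S.b⁻¹ * l.prod * S.b) by group]
    refine SecCostLE.mul ?_ (ih fun z hz => hl z (by simp [hz]))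
    rcases hl y (by simp) with rfl | rfl
    · exact S.secCostLE_conj_a.1
    · exact S.secCostLE_conj_a.2

theorem β_prod_nonneg {l : List G} (hl : ∀ y ∈ l, y ∈ S.letters) (hb : S.b⁻¹ ∉ l) :
    0 ≤ S.β l.prod ∧ (S.β l.prod = 0 → ∃ k : ℤ, l.prod = S.a ^ k) := by
  induction l with
  | nil => exact ⟨by simp, fun _ => ⟨0, by simp⟩⟩
  | cons y l ih =>
    obtain ⟨h1, h2⟩ := ih (fun z hz => hl z (by simp [hz])) fun h => hb (by simp [h])
    rw [List.prod_cons, S.β_mul]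
    rcases hl y (by simp) with rfl | rfl | rfl | rfl
    · refine ⟨by simpa, fun h => ?_⟩
      obtain ⟨k, hk⟩ := h2 (by simpa using h)
      exact ⟨1 + k, by rw [hk, zpow_add, zpow_one]⟩
    · refine ⟨by simpa, fun h => ?_⟩
      obtain ⟨k, hk⟩ := h2 (by simpa using h)
      exact ⟨-1 + k, by rw [hk, zpow_add, zpow_neg_one]⟩
    · rw [S.β_b]
      exact ⟨by omega, fun h => by omega⟩
    · exact absurd (by simp) hb

theorem β_prod_nonpos {l : List G} (hl : ∀ y ∈ l, y ∈ S.letters) (hb : S.b ∉ l) :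
    S.β l.prod ≤ 0 := by
  induction l with
  | nil => simp
  | cons y l ih =>
    have h1 := ih (fun z hz => hl z (by simp [hz])) fun h => hb (by simp [h])
    rw [List.prod_cons, S.β_mul]
    rcases hl y (by simp) with rfl | rfl | rfl | rfl
    · simpa
    · simpa
    · exact absurd (by simp) hb
    · rw [S.β_inv, S.β_b]
      omega

theorem _root_.List.exists_append_cons_notMem {T : Type} {x : T} {l : List T} (h : x ∈ l) :
    ∃ l₁ l₂, l = l₁ ++ x :: l₂ ∧ x ∉ l₂ := by
  obtain ⟨l₁, l₂, h1, h2⟩ := List.eq_append_cons_of_mem (List.mem_reverse.mpr h)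
  refine ⟨l₂.reverse, l₁.reverse, ?_, by simpa using h2⟩
  rw [← List.reverse_reverse l, h1]
  simp

theorem mem_conj_map {M : Subgroup G} {g h : G} (hh : h ∈ M) :
    g * h * g⁻¹ ∈ M.map (MulAut.conj g).toMonoidHom := ⟨h, hh, rfl⟩

/-- A word with a cyclic subword `b⁻¹ aᵏ b` has a conjugate with shorter sections. -/
theorem exists_conj_secCostLE {l : List G} (hl : ∀ y ∈ l, y ∈ S.letters) (h1 : S.b⁻¹ ∈ l)
    (h2 : S.b ∈ l) :
    ∃ (g : G) (n : ℕ), n < l.length ∧ S.SecCostLE ⊥ S.letters (g * l.prod * g⁻¹) n := by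
  have hbb : S.b ≠ S.b⁻¹ := by
    intro h
    have := congrArg S.β h
    rw [S.β_inv, S.β_b] at this
    omega
  obtain ⟨P, Q, rfl⟩ := List.append_of_mem h1
  have hb : S.b ∈ Q ++ P := by
    simp only [List.mem_append, List.mem_cons, hbb, false_or] at h2 ⊢
    exact h2.symm
  -- In the rotated word take the first `b` and then the last `b⁻¹` before it; only letters `a`,
  -- `a⁻¹` lie between.
  obtain ⟨R₁, R₂, hR, hR₁⟩ := List.eq_append_cons_of_mem hb
  obtain ⟨Q₁, Q₂, hQ, hQ₂⟩ := List.exists_append_cons_notMem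
    (show S.b⁻¹ ∈ S.b⁻¹ :: R₁ by simp)
  have hrot : S.b⁻¹ :: (Q ++ P) = Q₁ ++ S.b⁻¹ :: Q₂ ++ S.b :: R₂ := by
    rw [← hQ, hR]
    simp
  have hmem : ∀ y ∈ Q₁ ++ S.b⁻¹ :: Q₂ ++ S.b :: R₂, y ∈ S.letters := by
    intro y hy
    rw [← hrot] at hy
    refine hl y ?_
    simp only [List.mem_cons, List.mem_append] at hy ⊢
    tauto
  have hQ₂' : ∀ y ∈ Q₂, y = S.a ∨ y = S.a⁻¹ := by
    intro y hy
    rcases hmem y (by simp [hy]) with rfl | rfl | rfl | rfl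
    · simp
    · simp
    · have : S.b ∈ S.b⁻¹ :: R₁ := by
        rw [hQ]
        simp [hy]
      simp [hbb, hR₁] at this
    · exact absurd hy hQ₂
  refine ⟨P.prod⁻¹, Q₁.length + Q₂.length + R₂.length, ?_, ?_⟩
  · have := congrArg List.length hrot
    simp only [List.length_append, List.length_cons] at this ⊢
    omega
  · have h3 := congrArg List.prod hrot
    simp only [List.prod_append, List.prod_cons] at h3
    have h4 : P.prod⁻¹ * (P ++ S.b⁻¹ :: Q).prod * P.prod⁻¹⁻¹ =
        Q₁.prod * (S.b⁻¹ * Q₂.prod * S.b) * R₂.prod := by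
      rw [List.prod_append, List.prod_cons, inv_inv, inv_mul_cancel_left, mul_assoc, h3]
      group
    rw [h4]
    exact ((S.secCostLE_prod fun y hy => hmem y (by simp [hy])).mul
      (S.secCostLE_conj_prod hQ₂')).mul (S.secCostLE_prod fun y hy => hmem y (by simp [hy]))

/-- If `b⁻¹` occurs, a conjugate `s` has sections of smaller total length, and a section of `s ^ p`
multiplies them along the whole cycle, so it is represented by a shorter word. If `b⁻¹` does not
occur, `β = 1` leaves `aⁱ b aʲ` with `i + j = -1`, a conjugate of `b a⁻¹`. -/
theorem exists_coreFreeMaximal_mem_of_prod_mem (n : ℕ) : ∀ l : List G, l.length = n →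
    (∀ y ∈ l, y ∈ S.letters) → S.α l.prod = -1 → S.β l.prod = 1 →
    ∀ M : Subgroup G, CoreFreeMaximal M → l.prod ∈ M →
      ∃ M' : Subgroup G, CoreFreeMaximal M' ∧ S.b * S.a⁻¹ ∈ M' := by
  induction n using Nat.strong_induction_on with
  | _ n ih =>
    intro l hn hl hα hβ M hM hlM
    have hb : S.b ∈ l := by
      by_contra h
      have := S.β_prod_nonpos hl h
      omega
    by_cases hb' : S.b⁻¹ ∈ l
    · obtain ⟨g, k, hk, hg⟩ := S.exists_conj_secCostLE hl hb' hb
      have hM1 := hM.conj g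
      have hmem := mem_conj_map (g := g) hlM
      set s := g * l.prod * g⁻¹ with hs
      have hsα : S.α s = -1 := by rw [hs]; simp [hα]
      have hsβ : S.β s = 1 := by rw [hs]; simp [hβ]
      obtain ⟨f, f1, f2⟩ := hg
      obtain ⟨x, -⟩ := exists_last (p := p)
      have hact : ∀ y, S.act (s ^ p) y = y := fun y => by
        rw [S.act_eq_self_iff]
        simp
      have hc := S.costLE_sec_pow f2 p x
      rw [S.sum_orbit hsβ] at hc
      have hα' : S.α (S.sec (s ^ p) x) = 1 := by
        have h := S.α_sec_of_act (hact x)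
        rw [S.β_pow, hsβ] at h
        exact mul_left_cancel₀ (by exact_mod_cast (Fact.out : p.Prime).ne_zero) h
      have hβ' : S.β (S.sec (s ^ p) x) = -1 := by
        rw [S.β_sec_pow, S.sum_orbit hsβ fun y => S.β (S.sec s y), S.sum_β_sec, hsα]
      obtain ⟨M', hM', hsec⟩ := S.exists_coreFreeMaximal_sec_mem hM1 x
      -- The section has exponents `1` and `-1`; its inverse restores `-1` and `1`.
      obtain ⟨l', h1, h2, h3⟩ := (hc.inv S.inv_mem_letters).exists_list
      refine ih l'.length (by omega) l' rfl h3 ?_ ?_ M' hM' ?_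
      · rw [h1, S.α_inv, hα']
      · rw [h1, S.β_inv, hβ']
        rfl
      · rw [h1]
        exact M'.inv_mem (hsec _ (Subgroup.pow_mem _ hmem p) hact)
    · obtain ⟨P, Q, rfl⟩ := List.append_of_mem hb
      obtain ⟨hP1, hP2⟩ := S.β_prod_nonneg (l := P) (fun y hy => hl y (by simp [hy]))
        fun h => hb' (by simp [h])
      obtain ⟨hQ1, hQ2⟩ := S.β_prod_nonneg (l := Q) (fun y hy => hl y (by simp [hy]))
        fun h => hb' (by simp [h])
      rw [List.prod_append, List.prod_cons] at hα hβ hlM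
      simp only [S.β_mul, S.β_b] at hβ
      obtain ⟨i, hi⟩ := hP2 (by omega)
      obtain ⟨j, hj⟩ := hQ2 (by omega)
      rw [hi, hj] at hα hlM
      simp only [S.α_mul, S.α_zpow, S.α_a, S.α_b] at hα
      refine ⟨_, hM.conj (S.a ^ (-i)), ?_⟩
      convert mem_conj_map (g := S.a ^ (-i)) hlM using 1
      rw [show j = -1 + -i by omega]
      group

end BasilicaGroup

-- Core-free maximal subgroups containing `b a⁻¹`

namespace BasilicaGroup
variable {p : ℕ} {G : Type} [Group G] (S : BasilicaGroup p G)

/-- The element `b a⁻¹ = (1, …, 1, (b a⁻¹)⁻¹) σ`. -/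
def τ : G := S.b * S.a⁻¹

theorem b_eq : S.b = S.τ * S.a := by simp [τ]

variable [Fact p.Prime]

@[simp] theorem α_τ : S.α S.τ = -1 := by simp [τ]
@[simp] theorem β_τ : S.β S.τ = 1 := by simp [τ]

theorem sec_τ {l : Fin p} (hl : (l : ℕ) + 1 = p) (x : Fin p) :
    S.sec S.τ x = if x = l then S.τ⁻¹ else 1 := by
  rw [τ, S.sec_mul_of_act _ (S.act_inv_of_act S.act_a), S.sec_inv_of_act S.act_a, S.sec_a, S.sec_b]
  by_cases hx : x = l
  · subst hx
    rw [if_pos hl, if_pos hl, if_pos rfl]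
    simp
  · have : ¬ (x : ℕ) + 1 = p := fun h => hx (Fin.ext (by omega))
    rw [if_neg this, if_neg this, if_neg hx]
    simp

theorem sec_zpowers_τ (z : G) (hz : z ∈ Subgroup.zpowers S.τ) (x : Fin p) :
    S.sec z x ∈ Subgroup.zpowers S.τ := by
  obtain ⟨l, hl⟩ := exists_last (p := p)
  let W : Subgroup G :=
    { carrier := {z | ∀ x, S.sec z x ∈ Subgroup.zpowers S.τ}
      one_mem' := by simp
      mul_mem' := by
        intro g h hg hh x
        rw [S.sec_mul]
        exact Subgroup.mul_mem _ (hg _) (hh x)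
      inv_mem' := by
        intro g hg x
        rw [S.sec_inv]
        exact Subgroup.inv_mem _ (hg _) }
  have : Subgroup.zpowers S.τ ≤ W := by
    rw [Subgroup.zpowers_le]
    intro x
    rw [S.sec_τ hl]
    split_ifs
    · exact Subgroup.inv_mem _ (Subgroup.mem_zpowers _)
    · exact Subgroup.one_mem _
  exact this hz x

theorem act_τ_pow (x : Fin p) : S.act (S.τ ^ p) x = x := by
  rw [S.act_eq_self_iff]
  simp

theorem sec_τ_pow (x : Fin p) : S.sec (S.τ ^ p) x = S.τ⁻¹ := by
  obtain ⟨k, hk⟩ := S.sec_zpowers_τ _ (Subgroup.pow_mem _ (Subgroup.mem_zpowers S.τ) p) x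
  have h1 := S.β_sec_pow S.τ p x
  rw [S.sum_orbit S.β_τ fun y => S.β (S.sec S.τ y), S.sum_β_sec, S.α_τ] at h1
  simp only at hk
  rw [← hk, S.β_zpow, S.β_τ, mul_one] at h1
  rw [← hk, h1, zpow_neg_one]

theorem sec_τ_zpow_mul (e : ℤ) (x : Fin p) : S.sec (S.τ ^ (p * e)) x = S.τ ^ (-e) := by
  rw [zpow_mul, zpow_natCast, S.sec_zpow S.act_τ_pow, S.sec_τ_pow, inv_zpow, zpow_neg]

/-- The letters of cost one in words over `a` and `b a⁻¹`. -/
def aLetters : Set G := {S.a, S.a⁻¹}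

theorem sec_a_zpow {l : Fin p} (hl : (l : ℕ) + 1 = p) (e : ℤ) (x : Fin p) :
    S.sec (S.a ^ e) x = if x = l then S.b ^ e else 1 := by
  rw [S.sec_zpow S.act_a, S.sec_a]
  by_cases hx : x = l
  · subst hx
    rw [if_pos hl, if_pos rfl]
  · rw [if_neg fun h => hx (Fin.ext (by omega)), if_neg hx, one_zpow]

/-- A section `b` or `b⁻¹` costs one letter again; the powers of `τ` around it are recorded because
they govern the recursion for `d` in `false_of_two_letters`. -/
theorem b_zpow_eq {e : ℤ} (he : e = 1 ∨ e = -1) :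
    ∃ i j : ℤ, S.b ^ e = S.τ ^ i * S.a ^ e * S.τ ^ j ∧ 2 * i = 1 + e ∧ 2 * j = e - 1 := by
  rcases he with rfl | rfl
  · exact ⟨1, 0, by simp [S.b_eq], by norm_num, by norm_num⟩
  · exact ⟨0, -1, by simp [S.b_eq], by norm_num, by norm_num⟩

theorem costLE_a_zpow {e : ℤ} (he : e = 1 ∨ e = -1) :
    CostLE (Subgroup.zpowers S.τ) S.aLetters (S.a ^ e) 1 := by
  rcases he with rfl | rfl
  · exact .of_mem (by simp [aLetters])
  · exact .of_mem (by simp [aLetters])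

theorem costLE_b_zpow {e : ℤ} (he : e = 1 ∨ e = -1) :
    CostLE (Subgroup.zpowers S.τ) S.aLetters (S.b ^ e) 1 := by
  obtain ⟨i, j, h, -, -⟩ := S.b_zpow_eq he
  rw [h]
  exact ((S.costLE_a_zpow he).free_mul (Subgroup.zpow_mem_zpowers _ i)).mul
    (.free 0 (Subgroup.zpow_mem_zpowers _ j))

theorem zpow_of_mem_aLetters {y : G} (hy : y ∈ S.aLetters) :
    ∃ e : ℤ, (e = 1 ∨ e = -1) ∧ y = S.a ^ e := by
  rcases hy with rfl | rfl
  · exact ⟨1, by simp⟩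
  · exact ⟨-1, by simp⟩

theorem secCostLE_aLetters :
    ∀ y ∈ S.aLetters, S.SecCostLE (Subgroup.zpowers S.τ) S.aLetters y 1 := by
  obtain ⟨l, hl⟩ := exists_last (p := p)
  intro y hy
  obtain ⟨e, he, rfl⟩ := S.zpow_of_mem_aLetters hy
  refine .of_single l ?_ fun x hx => ?_
  · rw [S.sec_a_zpow hl, if_pos rfl]
    exact S.costLE_b_zpow he
  · rw [S.sec_a_zpow hl, if_neg hx]
    exact Subgroup.one_mem _

theorem α_add_β_zpowers {z : G} (hz : z ∈ Subgroup.zpowers S.τ) : S.α z + S.β z = 0 := by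
  obtain ⟨k, rfl⟩ := hz
  simp

/-- The descent for an element that begins with two letters `a` or `a⁻¹`, separated by a power of
`b a⁻¹`. -/
theorem false_of_two_letters {k : ℕ}
    (ih : ∀ m < k + 2, ∀ M : Subgroup G, CoreFreeMaximal M → S.τ ∈ M → ∀ s ∈ M,
      CostLE (Subgroup.zpowers S.τ) S.aLetters s m → S.α s + S.β s ≠ 0 → False)
    {e₁ e₂ c : ℤ} (h₁ : e₁ = 1 ∨ e₁ = -1) (h₂ : e₂ = 1 ∨ e₂ = -1) (hc : 2 * c = e₁ + e₂) (N : ℕ) :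
    ∀ d : ℤ, ((p + 1) * d - p * c).natAbs = N → ∀ M : Subgroup G, CoreFreeMaximal M → S.τ ∈ M →
      ∀ v, CostLE (Subgroup.zpowers S.τ) S.aLetters v k →
        S.a ^ e₁ * S.τ ^ d * S.a ^ e₂ * v ∈ M →
        S.α (S.a ^ e₁ * S.τ ^ d * S.a ^ e₂ * v) + S.β (S.a ^ e₁ * S.τ ^ d * S.a ^ e₂ * v) ≠ 0 →
          False := by
  have hp : p.Prime := Fact.out
  have hp2 := hp.two_le
  -- If the first two letters fall into different sections, or one misses the chosen section, the
  -- cost drops. If both fall into it, then `d = p * e` and the section has the same shape with `d`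
  -- replaced by `c - e`; the distance to the fixed point `p * c / (p + 1)` of this recursion
  -- decreases.
  induction N using Nat.strong_induction_on with
  | _ N ihN =>
    intro d hd M hM hτ v hv hs hχ
    by_cases hD : (p + 1) * d - p * c = 0
    · have hdvd : (p : ℤ) + 1 ∣ c := by
        have h : (p : ℤ) + 1 ∣ (p + 1) * (c - d) := dvd_mul_right _ _
        rwa [show ((p : ℤ) + 1) * (c - d) = c by linarith] at h
      -- `c` is `-1`, `0` or `1`, and `p + 1` divides it; so the fixed point is integral only for `c
      -- = d = 0`, when the two letters cancel.
      have hc0 : c = 0 := Int.eq_zero_of_abs_lt_dvd hdvd (abs_lt.mpr ⟨by omega, by omega⟩)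
      have hd0 : d = 0 := by
        rw [hc0, mul_zero, sub_zero] at hD
        exact (mul_eq_zero.mp hD).resolve_left (by omega)
      have he : S.a ^ e₁ * S.τ ^ d * S.a ^ e₂ * v = v := by
        rw [hd0, zpow_zero, mul_one, ← zpow_add, show e₁ + e₂ = 0 by omega, zpow_zero, one_mul]
      rw [he] at hs hχ
      exact ih k (by omega) M hM hτ v hs hv hχ
    obtain ⟨l, hl⟩ := exists_last (p := p)
    set u := S.a ^ e₁ * S.τ ^ d * S.a ^ e₂ with hu
    -- This power of `τ` makes `β (u * w) = 0`, so the letters are fixed and all sections have `α =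
    -- 0`. Their `β` add up to a nonzero number, so some section again has `α + β ≠ 0`.
    set w := v * S.τ ^ (-S.β (u * v)) with hw
    have hwc : CostLE (Subgroup.zpowers S.τ) S.aLetters w k := hv.mul (.free 0 ⟨_, rfl⟩)
    have hsM : u * w ∈ M := by
      rw [hw, ← mul_assoc]
      exact M.mul_mem hs (M.zpow_mem hτ _)
    have hβ : S.β (u * w) = 0 := by
      rw [hw, ← mul_assoc, S.β_mul (u * v)]
      simp
    have hα : S.α (u * w) ≠ 0 := by
      rw [hw, ← mul_assoc, S.α_mul (u * v)]
      simpa using hχ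
    have hact : ∀ x, S.act (u * w) x = x := fun x => by
      rw [S.act_eq_self_iff, hβ]
      exact dvd_zero _
    obtain ⟨x, -, hx⟩ := Finset.exists_ne_zero_of_sum_ne_zero (by rwa [S.sum_β_sec (u * w)])
    have hαx : S.α (S.sec (u * w) x) = 0 := by
      have := S.α_sec_of_act (hact x)
      rw [hβ] at this
      exact (mul_eq_zero.mp this).resolve_left (by exact_mod_cast hp.ne_zero)
    have hχx : S.α (S.sec (u * w) x) + S.β (S.sec (u * w) x) ≠ 0 := by rwa [hαx, zero_add]
    obtain ⟨M', hM', hsec⟩ := S.exists_coreFreeMaximal_sec_mem hM x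
    have hτ' : S.τ ∈ M' := by
      have := hsec _ (M.pow_mem hτ p) S.act_τ_pow
      rw [S.sec_τ_pow] at this
      exact inv_mem_iff.mp this
    have hsx := hsec _ hsM hact
    obtain ⟨f, f1, f2⟩ := hwc.secCostLE S.sec_zpowers_τ S.secCostLE_aLetters
    have hwx : CostLE (Subgroup.zpowers S.τ) S.aLetters (S.sec w x) k :=
      (f2 x).mono ((Finset.single_le_sum (fun _ _ => Nat.zero_le _) (Finset.mem_univ x)).trans f1)
    have hacta : ∀ (e : ℤ) y, S.act (S.a ^ e) y = y := fun e y => by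
      rw [S.act_eq_self_iff]
      simp
    have hdiv : ∀ y, S.act (S.τ ^ d) y = y ↔ (p : ℤ) ∣ d := fun y => by
      rw [S.act_eq_self_iff, S.β_zpow, S.β_τ, mul_one]
    have hux : S.sec (u * w) x = S.sec (S.a ^ e₁) (S.act (S.τ ^ d) (S.act w x)) *
        S.sec (S.τ ^ d) (S.act w x) * S.sec (S.a ^ e₂) (S.act w x) * S.sec w x := by
      rw [S.sec_mul, hu, S.sec_mul, S.sec_mul, hacta]
    set y := S.act w x with hy
    have hz : S.sec (S.τ ^ d) y ∈ Subgroup.zpowers S.τ := S.sec_zpowers_τ _ ⟨d, rfl⟩ y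
    rw [S.sec_a_zpow hl, S.sec_a_zpow hl] at hux
    by_cases hyl : y = l
    · by_cases hpd : (p : ℤ) ∣ d
      · obtain ⟨e, rfl⟩ := hpd
        rw [(hdiv y).mpr ⟨e, rfl⟩, S.sec_τ_zpow_mul, if_pos hyl, if_pos hyl] at hux
        obtain ⟨i₁, j₁, hb₁, hi₁, hj₁⟩ := S.b_zpow_eq h₁
        obtain ⟨i₂, j₂, hb₂, hi₂, hj₂⟩ := S.b_zpow_eq h₂
        have hnew : S.τ ^ (-i₁) * S.sec (u * w) x =
            S.a ^ e₁ * S.τ ^ (c - e) * S.a ^ e₂ * (S.τ ^ j₂ * S.sec w x) := by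
          rw [hux, hb₁, hb₂, show c - e = j₁ + -e + i₂ by omega]
          simp only [zpow_add, zpow_neg, mul_assoc, inv_mul_cancel_left]
        -- The measured quantity is divided by `-p`.
        have hDe : ((p : ℤ) + 1) * (p * e) - p * c = p * -((p + 1) * (c - e) - p * c) := by ring
        refine ihN _ ?_ (c - e) rfl M' hM' hτ' (S.τ ^ j₂ * S.sec w x)
          (hwx.free_mul ⟨_, rfl⟩) ?_ ?_
        · rw [← hd, hDe, Int.natAbs_mul, Int.natAbs_neg, Int.natAbs_natCast]
          have h0 : ((p + 1) * (c - e) - p * c : ℤ).natAbs ≠ 0 := by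
            intro h
            rw [Int.natAbs_eq_zero] at h
            exact hD (by rw [hDe, h]; simp)
          exact lt_mul_of_one_lt_left (Nat.pos_of_ne_zero h0) hp.one_lt
        · rw [← hnew]
          exact M'.mul_mem (M'.zpow_mem hτ' _) hsx
        · rw [← hnew, S.α_mul, S.β_mul, S.α_zpow, S.β_zpow, S.α_τ, S.β_τ]
          intro h
          exact hχx (by linarith)
      · have hne : S.act (S.τ ^ d) y ≠ l := fun h => hpd ((hdiv y).mp (h.trans hyl.symm))
        rw [if_neg hne, if_pos hyl, one_mul] at hux
        refine ih (1 + k) (by omega) M' hM' hτ' _ hsx ?_ hχx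
        rw [hux]
        exact ((S.costLE_b_zpow h₂).free_mul hz).mul hwx
    · rw [if_neg hyl, mul_one] at hux
      refine ih (1 + k) (by omega) M' hM' hτ' _ hsx ?_ hχx
      rw [hux]
      refine CostLE.mul ?_ hwx
      split_ifs
      · exact (S.costLE_b_zpow h₁).mul (.free 0 hz)
      · rw [one_mul]
        exact .free 1 hz

/-- Cost zero means a power of `τ`, on which `α + β` vanishes; cost one puts `a`, hence also `b = τ
a`, into `M`; from cost two on `false_of_two_letters` takes over. -/
theorem false_of_costLE (n : ℕ) : ∀ M : Subgroup G, CoreFreeMaximal M → S.τ ∈ M → ∀ s ∈ M,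
    CostLE (Subgroup.zpowers S.τ) S.aLetters s n → S.α s + S.β s ≠ 0 → False := by
  induction n using Nat.strong_induction_on with
  | _ n ih =>
    intro M hM hτ s hs hc hχ
    have hZ : ∀ z ∈ Subgroup.zpowers S.τ, z ∈ M := fun z hz =>
      (Subgroup.zpowers_le.mpr hτ : Subgroup.zpowers S.τ ≤ M) hz
    cases hc with
    | free n hz => exact hχ (S.α_add_β_zpowers hz)
    | @cons z y g n hz hy hg =>
      rw [mul_assoc] at hs hχ
      rw [S.α_mul, S.β_mul, add_add_add_comm, S.α_add_β_zpowers hz, zero_add] at hχ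
      replace hs := (M.mul_mem_cancel_left (hZ z hz)).mp hs
      obtain ⟨e₁, he₁, rfl⟩ := S.zpow_of_mem_aLetters hy
      cases hg with
      | free n hz' =>
        have h1 := (M.mul_mem_cancel_right (hZ _ hz')).mp hs
        have ha : S.a ∈ M := by
          rcases he₁ with rfl | rfl
          · simpa using h1
          · simpa using h1
        have hb : S.b ∈ M := by
          rw [S.b_eq]
          exact M.mul_mem hτ ha
        refine hM.isCoatom.1 (top_le_iff.mp ?_)
        rw [← S.closure_eq, Subgroup.closure_le]
        rintro g (rfl | rfl)
        · exact ha
        · exact hb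
      | @cons z' y' v k hz' hy' hv =>
        obtain ⟨e₂, he₂, rfl⟩ := S.zpow_of_mem_aLetters hy'
        obtain ⟨d, rfl⟩ := hz'
        simp only [← mul_assoc] at hs hχ
        obtain ⟨c, hc⟩ : ∃ c : ℤ, 2 * c = e₁ + e₂ := ⟨(e₁ + e₂) / 2, by omega⟩
        exact S.false_of_two_letters ih he₁ he₂ hc _ d rfl M hM hτ v hv hs hχ

theorem exists_costLE_letters (g : G) : ∃ n, CostLE ⊥ S.letters g n := by
  refine S.induction_gen (P := fun g => ∃ n, CostLE ⊥ S.letters g n)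
    ⟨1, .of_mem (by simp [letters])⟩ ⟨1, .of_mem (by simp [letters])⟩
    ⟨0, .free 0 (Subgroup.one_mem _)⟩ ?_ ?_ g
  · rintro g h ⟨m, hm⟩ ⟨n, hn⟩
    exact ⟨_, hm.mul hn⟩
  · rintro g ⟨m, hm⟩
    exact ⟨m, hm.inv S.inv_mem_letters⟩

theorem exists_costLE_aLetters (g : G) :
    ∃ n, CostLE (Subgroup.zpowers S.τ) S.aLetters g n := by
  refine S.induction_gen (P := fun g => ∃ n, CostLE (Subgroup.zpowers S.τ) S.aLetters g n)
    ⟨1, .of_mem (by simp [aLetters])⟩ ⟨1, by simpa using S.costLE_b_zpow (Or.inl rfl)⟩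
    ⟨0, .free 0 (Subgroup.one_mem _)⟩ ?_ ?_ g
  · rintro g h ⟨m, hm⟩ ⟨n, hn⟩
    exact ⟨_, hm.mul hn⟩
  · rintro g ⟨m, hm⟩
    exact ⟨m, hm.inv (by rintro _ (rfl | rfl) <;> simp [aLetters])⟩

theorem not_coreFreeMaximal (S : BasilicaGroup p G) (M : Subgroup G) : ¬ CoreFreeMaximal M := by
  intro hM
  obtain ⟨m, hm, k, hk, hmk⟩ := hM.exists_mul_eq S.expKer_ne_bot S.τ
  obtain ⟨k1, k2⟩ := S.mem_expKer.mp hk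
  have hα : S.α m = -1 := by simpa [k1] using congrArg S.α hmk
  have hβ : S.β m = 1 := by simpa [k2] using congrArg S.β hmk
  obtain ⟨n, hn⟩ := S.exists_costLE_letters m
  obtain ⟨l, rfl, -, hl⟩ := hn.exists_list
  obtain ⟨M', hM', hτ⟩ := S.exists_coreFreeMaximal_mem_of_prod_mem _ l rfl hl hα hβ M hM hm
  obtain ⟨s, hs, k, hk, hsk⟩ := hM'.exists_mul_eq S.expKer_ne_bot S.a
  obtain ⟨k1, k2⟩ := S.mem_expKer.mp hk
  have hα : S.α s = 1 := by simpa [k1] using congrArg S.α hsk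
  have hβ : S.β s = 0 := by simpa [k2] using congrArg S.β hsk
  obtain ⟨n, hn⟩ := S.exists_costLE_aLetters s
  exact S.false_of_costLE n M' hM' hτ s hs hn (by rw [hα, hβ]; norm_num)

theorem finiteIndex_of_isCoatom (S : BasilicaGroup p G) {M : Subgroup G} (hM : IsCoatom M) :
    M.FiniteIndex :=
  (S.finiteIndex_or_coreFreeMaximal hM).resolve_right (S.not_coreFreeMaximal M)

end BasilicaGroup

-- Affine actions and non-normal maximal subgroups

namespace BasilicaGroup
variable {p : ℕ} {G : Type} [Group G] (S : BasilicaGroup p G) [Fact p.Prime]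
variable {q : ℕ} [Fact q.Prime] (ω : (ZMod q)ˣ)

/-- The translation part of the action of `g` on `ZMod q` by affine maps. -/
noncomputable def translation (g : G) : ZMod q :=
  ∑ x, ((ω ^ (S.act g x : ℕ) : (ZMod q)ˣ) : ZMod q) * (S.β (S.sec g x) : ℤ)

variable {ω}

theorem pow_act (hω : ω ^ p = 1) (g : G) (x : Fin p) :
    ω ^ (S.act g x : ℕ) = ω ^ S.β g * ω ^ (x : ℕ) := by
  have h := S.p_mul_α_sec g x
  rw [← zpow_natCast, ← zpow_natCast, ← zpow_add, ← h, zpow_add, zpow_mul, zpow_natCast ω p, hω,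
    one_zpow, one_mul]

/-- The cocycle identity behind the affine action: `β` is additive on sections, and moving letters
by `g` multiplies the weights by `ω ^ β g` because `ω ^ p = 1`. -/
theorem translation_mul (hω : ω ^ p = 1) (g h : G) :
    S.translation ω (g * h) =
      S.translation ω g + ((ω ^ S.β g : (ZMod q)ˣ) : ZMod q) * S.translation ω h := by
  simp only [translation]
  rw [← Equiv.sum_comp (S.actEquiv h) fun x =>
    ((ω ^ (S.act g x : ℕ) : (ZMod q)ˣ) : ZMod q) * (S.β (S.sec g x) : ℤ), Finset.mul_sum,
    ← Finset.sum_add_distrib]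
  refine Finset.sum_congr rfl fun x _ => ?_
  rw [S.actEquiv_apply, S.act_mul, S.sec_mul, S.β_mul]
  have h2 := congrArg (Units.val) (S.pow_act hω g (S.act h x))
  rw [Units.val_mul] at h2
  rw [h2]
  push_cast
  ring

/-- The affine action of `G` on `ZMod q` given by an element `ω` of order `p`, where `b` acts as
multiplication by `ω` and `a` as a translation. -/
@[reducible] noncomputable def affineAction (hω : ω ^ p = 1) : MulAction G (ZMod q) where
  smul g z := ((ω ^ S.β g : (ZMod q)ˣ) : ZMod q) * z + S.translation ω g
  one_smul z := by
    change ((ω ^ S.β 1 : (ZMod q)ˣ) : ZMod q) * z + S.translation ω 1 = z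
    simp [translation]
  mul_smul g h z := by
    change ((ω ^ S.β (g * h) : (ZMod q)ˣ) : ZMod q) * z + S.translation ω (g * h) =
      ((ω ^ S.β g : (ZMod q)ˣ) : ZMod q) *
        (((ω ^ S.β h : (ZMod q)ˣ) : ZMod q) * z + S.translation ω h) + S.translation ω g
    rw [S.translation_mul hω, S.β_mul, zpow_add, Units.val_mul]
    ring

theorem exists_nonnormal_maximal (S : BasilicaGroup p G) (hq : p ∣ q - 1) :
    ∃ M : Subgroup G, IsCoatom M ∧ ¬ M.Normal ∧ M.index = q := by
  have hqp : q.Prime := Fact.out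
  obtain ⟨ω, hω⟩ := exists_prime_orderOf_dvd_card (G := (ZMod q)ˣ) p (by
    rwa [ZMod.card_units_eq_totient, Nat.totient_prime hqp])
  have hωp : ω ^ p = 1 := hω ▸ pow_orderOf_eq_one ω
  have hω1 : ω ≠ 1 := by
    rintro rfl
    rw [orderOf_one] at hω
    exact (Fact.out : p.Prime).ne_one hω.symm
  let _ := S.affineAction hωp
  have hsmul : ∀ (g : G) (z : ZMod q),
      g • z = ((ω ^ S.β g : (ZMod q)ˣ) : ZMod q) * z + S.translation ω g := fun _ _ => rfl
  obtain ⟨l, hl⟩ := exists_last (p := p)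
  have ha : S.translation ω S.a = ((ω ^ (l : ℕ) : (ZMod q)ˣ) : ZMod q) := by
    rw [translation, Finset.sum_eq_single l]
    · rw [S.act_a, S.sec_a, if_pos hl]
      simp
    · intro x _ hx
      rw [S.sec_a, if_neg fun h => hx (Fin.ext (by omega))]
      simp
    · simp
  have hb : S.translation ω S.b = 0 := by
    refine Finset.sum_eq_zero fun x _ => ?_
    rw [S.sec_b]
    split_ifs <;> simp
  have hapow : ∀ (n : ℕ) (z : ZMod q),
      (S.a ^ n) • z = z + n * ((ω ^ (l : ℕ) : (ZMod q)ˣ) : ZMod q) := by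
    intro n z
    induction n with
    | zero => simp
    | succ n ih =>
      rw [pow_succ', mul_smul, ih, hsmul, ha]
      simp
      ring
  have htrans : MulAction.IsPretransitive G (ZMod q) := by
    refine ⟨fun x y => ⟨S.a ^ ((y - x) * ((ω ^ (l : ℕ))⁻¹ : (ZMod q)ˣ)).val, ?_⟩⟩
    rw [hapow, ZMod.natCast_val, ZMod.cast_id, mul_assoc, ← Units.val_mul, inv_mul_cancel]
    simp
  have hidx : (MulAction.stabilizer G (0 : ZMod q)).index = q := by
    rw [MulAction.index_stabilizer_of_transitive, Nat.card_zmod]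
  have hbmem : S.b ∈ MulAction.stabilizer G (0 : ZMod q) := by
    rw [MulAction.mem_stabilizer_iff, hsmul, hb]
    simp
  refine ⟨MulAction.stabilizer G (0 : ZMod q), ⟨fun h => ?_, fun K hK => ?_⟩, fun hN => ?_, hidx⟩
  · rw [h, Subgroup.index_top] at hidx
    exact hqp.ne_one hidx.symm
  · have h1 := Subgroup.relIndex_mul_index hK.le
    rw [hidx] at h1
    rcases (Nat.dvd_prime hqp).mp (Dvd.intro_left _ h1) with h2 | h2
    · exact Subgroup.index_eq_one.mp h2
    · rw [h2] at h1
      have h3 : (MulAction.stabilizer G (0 : ZMod q)).relIndex K = 1 :=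
        Nat.eq_of_mul_eq_mul_right hqp.pos (by rw [h1, one_mul])
      exact absurd (Subgroup.relIndex_eq_one.mp h3) hK.not_ge
  -- Normality would put `a⁻¹ b a` into the stabilizer of `0`; then `b` would fix the nonzero
  -- translation of `a`, forcing `ω = 1`.
  · have h1 := hN.conj_mem _ hbmem S.a⁻¹
    rw [inv_inv, MulAction.mem_stabilizer_iff, mul_smul, mul_smul, inv_smul_eq_iff, hsmul S.a,
      hsmul S.b, ha, hb] at h1
    simp only [mul_zero, zero_add, S.β_b, zpow_one, add_zero] at h1
    rw [← Units.val_mul, Units.val_inj] at h1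
    exact hω1 (mul_eq_right.mp h1)

theorem infinite_nonnormal_maximal (S : BasilicaGroup p G) :
    {M : Subgroup G | IsCoatom M ∧ ¬ M.Normal}.Infinite := by
  refine Set.Infinite.of_image Subgroup.index ?_
  -- Already the indices are infinite in number, by the infinitude of primes `q ≡ 1` mod `p`.
  refine (Nat.infinite_setOfPred_prime_modEq_one (Fact.out : p.Prime).ne_zero).mono ?_
  rintro q ⟨hq, hqp⟩
  have : Fact q.Prime := ⟨hq⟩
  obtain ⟨M, h1, h2, h3⟩ := S.exists_nonnormal_maximal (q := q)
    ((Nat.modEq_iff_dvd' hq.one_le).mp hqp.symm)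
  exact ⟨M, ⟨h1, h2⟩, h3⟩

end BasilicaGroup

-- The group of tree automorphisms as a `BasilicaGroup`

namespace PBasilica

theorem val_finRotate {p : ℕ} (x : Fin p) :
    (finRotate p x : ℕ) = if (x : ℕ) + 1 = p then 0 else (x : ℕ) + 1 := by
  obtain _ | n := p
  · exact x.elim0
  · rw [finRotate_apply, Fin.val_add_one]
    simp only [Fin.ext_iff, Fin.val_last, Nat.add_right_cancel_iff]

theorem exists_sections {p : ℕ} (g : pBasilica p) : g.1 [] = [] ∧
    ∃ (r : Equiv.Perm (Fin p)) (f : Fin p → pBasilica p),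
      ∀ x v, g.1 (x :: v) = r x :: (f x).1 v := by
  have ha : a p ∈ pBasilica p := Subgroup.subset_closure (Or.inl rfl)
  have hb : b p ∈ pBasilica p := Subgroup.subset_closure (Or.inr rfl)
  obtain ⟨g, hg⟩ := g
  induction hg using Subgroup.closure_induction with
  | mem g hg =>
    rcases hg with rfl | rfl
    · refine ⟨by simp [a, aFun], 1,
        fun x => if (x : ℕ) + 1 = p then ⟨b p, hb⟩ else 1, fun x v => ?_⟩
      change aFun p (x :: v) = _
      rw [aFun]
      by_cases h : (x : ℕ) + 1 = p
      · simp only [if_pos h]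
        rfl
      · simp only [if_neg h]
        rfl
    · refine ⟨by simp [b, bFun], finRotate p,
        fun x => if (x : ℕ) + 1 = p then ⟨a p, ha⟩ else 1, fun x v => ?_⟩
      change bFun p (x :: v) = _
      rw [bFun]
      by_cases h : (x : ℕ) + 1 = p
      · simp only [if_pos h]
        rfl
      · simp only [if_neg h]
        rfl
  | one => exact ⟨rfl, 1, fun _ => 1, fun x v => rfl⟩
  | mul g h _ _ ihg ihh =>
    obtain ⟨g0, r, f, hf⟩ := ihg
    obtain ⟨h0, s, k, hk⟩ := ihh
    refine ⟨?_, r * s, fun x => f (s x) * k x, fun x v => ?_⟩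
    · change g (h []) = []
      rw [h0, g0]
    · change g (h (x :: v)) = _
      rw [hk, hf]
      rfl
  | inv g _ ih =>
    obtain ⟨g0, r, f, hf⟩ := ih
    have hinv : ∀ u w, g u = w → g⁻¹ w = u := fun u w h => by
      rw [← h]
      exact g.symm_apply_apply u
    refine ⟨hinv _ _ g0, r⁻¹, fun x => (f (r⁻¹ x))⁻¹, fun x v => hinv _ _ ?_⟩
    rw [hf]
    congr 1
    · exact r.apply_symm_apply x
    · exact (f (r⁻¹ x)).1.apply_symm_apply v

/-- The action on letters of an element of the `p`-Basilica group. -/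
noncomputable def letterAct {p : ℕ} (g : pBasilica p) : Equiv.Perm (Fin p) :=
  (exists_sections g).2.choose

/-- The sections of an element of the `p`-Basilica group. -/
noncomputable def letterSec {p : ℕ} (g : pBasilica p) : Fin p → pBasilica p :=
  (exists_sections g).2.choose_spec.choose

theorem apply_cons {p : ℕ} (g : pBasilica p) (x : Fin p) (v : List (Fin p)) :
    g.1 (x :: v) = letterAct g x :: (letterSec g x).1 v :=
  (exists_sections g).2.choose_spec.choose_spec x v

theorem eq_of_apply_cons {p : ℕ} {g : pBasilica p} {x y : Fin p} {h : pBasilica p}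
    (hg : ∀ v, g.1 (x :: v) = y :: h.1 v) : letterAct g x = y ∧ letterSec g x = h := by
  have h1 : ∀ v, letterAct g x = y ∧ (letterSec g x).1 v = h.1 v := fun v => by
    have := hg v
    rw [apply_cons] at this
    exact List.cons.inj this
  exact ⟨(h1 []).1, Subtype.ext (RelIso.ext fun v => (h1 v).2)⟩

theorem letter_mul {p : ℕ} (g h : pBasilica p) (x : Fin p) :
    letterAct (g * h) x = letterAct g (letterAct h x) ∧
      letterSec (g * h) x = letterSec g (letterAct h x) * letterSec h x :=
  eq_of_apply_cons fun v => by
    change g.1 (h.1 (x :: v)) = _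
    rw [apply_cons, apply_cons]
    rfl

/-- The self-similar structure of the `p`-Basilica group. -/
noncomputable def basilicaGroup (p : ℕ) : BasilicaGroup p (pBasilica p) :=
  have ha : ∀ x, letterAct ⟨a p, Subgroup.subset_closure (Or.inl rfl)⟩ x = x ∧
      letterSec ⟨a p, Subgroup.subset_closure (Or.inl rfl)⟩ x = if (x : ℕ) + 1 = p then
        (⟨b p, Subgroup.subset_closure (Or.inr rfl)⟩ : pBasilica p) else 1 := fun x =>
    eq_of_apply_cons fun v => by
      change aFun p (x :: v) = _
      rw [aFun]
      by_cases h : (x : ℕ) + 1 = p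
      · simp only [if_pos h]
        rfl
      · simp only [if_neg h]
        rfl
  have hb : ∀ x, letterAct ⟨b p, Subgroup.subset_closure (Or.inr rfl)⟩ x = finRotate p x ∧
      letterSec ⟨b p, Subgroup.subset_closure (Or.inr rfl)⟩ x = if (x : ℕ) + 1 = p then
        (⟨a p, Subgroup.subset_closure (Or.inl rfl)⟩ : pBasilica p) else 1 := fun x =>
    eq_of_apply_cons fun v => by
      change bFun p (x :: v) = _
      rw [bFun]
      by_cases h : (x : ℕ) + 1 = p
      · simp only [if_pos h]
        rfl
      · simp only [if_neg h]
        rfl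
  { a := ⟨a p, Subgroup.subset_closure (Or.inl rfl)⟩
    b := ⟨b p, Subgroup.subset_closure (Or.inr rfl)⟩
    act := fun g => letterAct g
    sec := letterSec
    act_one := fun x => (eq_of_apply_cons (h := 1) fun v => rfl).1
    sec_one := fun x => (eq_of_apply_cons (y := x) fun v => rfl).2
    act_mul := fun g h x => (letter_mul g h x).1
    sec_mul := fun g h x => (letter_mul g h x).2
    act_a := fun x => (ha x).1
    act_b := fun x => by rw [(hb x).1, val_finRotate]
    sec_a := fun x => (ha x).2
    sec_b := fun x => (hb x).2
    closure_eq := by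
      have h := Subgroup.closure_closure_coe_preimage (k := {a p, b p})
      refine Eq.trans (congrArg Subgroup.closure ?_) h
      ext g
      simp only [Set.mem_insert_iff, Set.mem_singleton_iff, Subtype.ext_iff]
      exact Iff.rfl
    faithful := by
      intro P hP g hg
      have key : ∀ v : List (Fin p), ∀ g, P g → g.1 v = v := by
        intro v
        induction v with
        | nil => exact fun g _ => (exists_sections g).1
        | cons x v ih =>
          intro g hg
          rw [apply_cons, (hP g hg x).1, ih _ (hP g hg x).2]
      exact Subtype.ext (RelIso.ext fun v => key v g hg) }

end PBasilica

theorem theorem1p4 (p : ℕ) (hp : p.Prime) :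
    (∀ M : Subgroup (pBasilica p), IsCoatom M → M.FiniteIndex) ∧
    {M : Subgroup (pBasilica p) | IsCoatom M ∧ ¬ M.Normal}.Infinite ∧
    (∀ q : ℕ, q.Prime → p ∣ q - 1 →
      ∃ M : Subgroup (pBasilica p), IsCoatom M ∧ ¬ M.Normal ∧ M.index = q) := by
  have : Fact p.Prime := ⟨hp⟩
  refine ⟨fun M hM => (PBasilica.basilicaGroup p).finiteIndex_of_isCoatom hM,
    (PBasilica.basilicaGroup p).infinite_nonnormal_maximal, fun q hq hpq => ?_⟩
  have : Fact q.Prime := ⟨hq⟩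
  exact (PBasilica.basilicaGroup p).exists_nonnormal_maximal hpq
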